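/- **Setting.** Let $\mathcal X\subset\mathbb R^d$ be closed, convex and bounded, with $\ell_2$-diameter $\|\mathcal X\|$; let $m\ge 0$ be the memory length, $T\ge\max(m,2)$ the horizon and $\mathcal T=\{m,\dots,T\}$. In round $t$ the loss and the constraint are separable with memory and linear: $f_t(x_{t-m},\dots,x_t)=\sum_{i=0}^m f_t^i(x_{t-i})$ and $g_t(x_{t-m},\dots,x_t)=\sum_{i=0}^m g_t^i(x_{t-i})$, where $f_t^i,g_t^i$ are affine on $\mathbb R^d$ (with gradients $\nabla f_t^i$, $\nabla g_t^i$). For $t\in\mathcal T$ one has $|f_t|\le F$ and $|g_t|\le G$ on $\mathcal X^{m+1}$, $G>0$, and $f_t$, $g_t$ are Lipschitz on $(\mathbb R^d)^{m+1}$ with constants $L_f$, $L_g$ for the $\ell_2$ norm; $f_t=g_t=0$ for $t\le m$ and for $t>T$. Write $z^+=\max\{z,0\}$, and let $g_t^{i,+}=(g_t^i)^+$. The benchmark set $$\mathcal X_T^{mp}=\{u\in\mathcal X:\ g_t^i(u)\le 0\ \ \forall t\in\mathcal T,\ 0\le i\le m\}$$ is assumed nonempty. For decisions $x_0,x_1,\dots\in\mathcal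 X$ put $V_t=\sum_{k=m}^t g_k^+(x_{k-m},\dots,x_k)$ (so $V_t=0$ for $t\le m$, also for negative $t$), and $$\mathcal R_T^{mc}=\sum_{t=m}^T f_t(x_{t-m},\dots,x_t)-\min_{u\in\mathcal X_T^{mp}}\sum_{t=m}^T f_t(u,\dots,u),\qquad \mathcal V_T^{mc}=V_T .$$ **Algorithm.** Let $\Phi(V)=e^{\lambda V}-1$, $w_k=\Phi'(V_{k-m-1})$, and let $\nabla g_{s+i}^{i,+}$ denote a subgradient of $g_{s+i}^{i,+}$ at $x_s$. The forward function $Z_s(x)=\sum_{i=0}^m f_{s+i}^i(x)+w_{s+i}\,g_{s+i}^{i,+}(x)$ has the (sub)gradient $\nabla Z_s=\sum_{i=0}^m(\nabla f_{s+i}^i+w_{s+i}\nabla g_{s+i}^{i,+})$ at $x_s$. Before $x_t$ is chosen, an untrusted oracle supplies arbitrary forecasts $\nabla\tilde f_{s+i}^i$ and $\nabla\tilde g_{s+i}^{i,+}$ of the slices that are still unknown ($t-m\le s\le t\le s+i$), of norm at most $L_f$ and $L_g$; they may be revised in every round. (Indices $s<0$ are omitted throughout.) The hint is $$h_t=\sum_{s=t-m}^t\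 \sum_{i=0}^m\begin{cases}\nabla f_{s+i}^i+w_{s+i}\nabla g_{s+i}^{i,+}, & s+i<t,\\ \nabla\tilde f_{s+i}^i+w_{s+i}\nabla\tilde g_{s+i}^{i,+}, & s+i\ge t.\end{cases}$$ Let $\alpha>0$, and let $r$ be a $1$-strongly convex function on $\mathcal X$ with $0\le r\le\rho$ there. With $e_t=\|h_t-\sum_{s=t-m}^t\nabla Z_s\|$, $a_t=\|\mathcal X\|\min(e_t,\|\nabla Z_t\|)$ and $b_t=\tfrac12e_t^2-\tfrac12\big((e_t-\|\nabla Z_t\|)^+\big)^2$, ODAF starts from an arbitrary initial history in $\mathcal X$ (rounds $0,\dots,m+1$) and chooses, for $t=m+1,\dots,T-1$, $$x_{t+1}\in\arg\min_{x\in\mathcal X}\Big\langle \sum_{s=1}^{t-m}\nabla Z_s+h_{t+1},x\Big\rangle+\mu_{t+1}r(x),\qquad \mu_{t+1}=\frac2\alpha\max_{j\le t-m-1}\ \sum_{k=j-m+1}^{j}a_k+\frac1\alpha\sqrt{\sum_{i=1}^{t-m}(a_i^2+2\alpha b_i)} ,$$ where $a_k=0$ for $k\le 0$ and the maximum over an empty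 set of indices is $0$. **Prediction errors.** $\mathcal E_T(f)=\sum_{t=m}^T\epsilon_t(f)$ and $\mathcal E_T(g^+)=\sum_{t=m}^T\epsilon_t(g^+)$, where $$\epsilon_t(f)=\Big\|\sum_{s=t-m}^t\sum_{i=t-s}^m(\nabla\tilde f_{s+i}^i-\nabla f_{s+i}^i)\Big\|^2,\qquad \epsilon_t(g^+)=\max_{t\le k\le t+m}\Big\|\sum_{s=t-m}^t\sum_{i=k-s}^m(\nabla\tilde g_{s+i}^{i,+}-\nabla g_{s+i}^{i,+})\Big\|^2 ,$$ the forecasts being those available when $x_t$ is chosen. **Theorem.** Put $C_0=\sqrt2\,(\rho/\alpha+1)\big(2m\|\mathcal X\|+\sqrt{\|\mathcal X\|^2+\alpha}\big)$, let $C\ge C_0$, and let $$\lambda=\frac1{2\left(C\sqrt{\mathcal E_T(g^+)}+G(m+1)\right)} .$$ Then $$\mathcal R_T^{mc}\le C_0\sqrt{\mathcal E_T(f)}+A_m,\qquad \mathcal V_T^{mc}\le K\left(C\sqrt{\mathcal E_T(g^+)}+m+1\right)\log T .$$ Here $K$ depends only on $\alpha,\rho,F,G,L_f,L_g$ and an upper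 bound $D$ for $\|\mathcal X\|$, and $A_m$ only on these and on $m$; neither depends on $d$, $T$, $C$, the functions, the forecasts, $r$ or the run. That is, $\mathcal R_T^{mc}=\mathcal O(1+\sqrt{\mathcal E_T(f)})$ and $\mathcal V_T^{mc}=\mathcal O\big((\sqrt{\mathcal E_T(g^+)}+m+1)\log T\big)$ for fixed $C$ and $m$. -/

import Mathlib

open scoped RealInnerProductSpace

namespace CocoMemory

/-- The ambient space `ℝ^d` with its `ℓ₂` norm. -/
abbrev Space (d : ℕ) := EuclideanSpace ℝ (Fin d)

/-- A linear (affine) function `x ↦ ⟪slope, x⟫ + offset` on `ℝ^d`; its gradient is `slope`. -/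
structure LinFun (d : ℕ) where
  slope : Space d
  offset : ℝ

/-- The value of a linear function at a point. -/
noncomputable def LinFun.eval {d : ℕ} (φ : LinFun d) (x : Space d) : ℝ :=
  ⟪φ.slope, x⟫ + φ.offset

/-- The value of the separable memory function with components `φ 0, …, φ m`;
`y i` is the argument of component `i`, i.e. the decision that was made `i` rounds ago. -/
noncomputable def memVal {d : ℕ} (m : ℕ) (φ : ℕ → LinFun d) (y : ℕ → Space d) : ℝ :=
  ∑ i ∈ Finset.range (m + 1), (φ i).eval (y i)

/-- The data of the online problem with memory length `m` and horizon `T`: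
`f t i` and `g t i` are the components `f_t^i`, `g_t^i` that act on the decision of round `t - i`. -/
structure Problem (d : ℕ) where
  m : ℕ
  T : ℕ
  X : Set (Space d)
  f : ℕ → ℕ → LinFun d
  g : ℕ → ℕ → LinFun d

/-- Everything that the learner uses or produces.
* `x t` is the decision of round `t`;
* `gradG s i` is the (sub)gradient of `g_{s+i}^{i,+}` at `x s`;
* `predF t s i`, `predG t s i` are the forecasts, available when `x t` is chosen, of the gradients
  of `f_{s+i}^i` and `g_{s+i}^{i,+}` at `x s`;
* `r` is the regularizer, `α` the parameter of its adaptive weight, `lam` the penalty parameter. -/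
structure Run (d : ℕ) where
  x : ℕ → Space d
  gradG : ℕ → ℕ → Space d
  predF : ℕ → ℕ → ℕ → Space d
  predG : ℕ → ℕ → ℕ → Space d
  r : Space d → ℝ
  α : ℝ
  lam : ℝ

/-- `v` is a subgradient of `φ` at `x`. -/
def IsSubgradientAt {d : ℕ} (φ : Space d → ℝ) (v x : Space d) : Prop :=
  ∀ y, φ x + ⟪v, y - x⟫ ≤ φ y

/-- The penalty function `Φ(V) = exp(λ V) - 1`. -/
noncomputable def penalty (lam V : ℝ) : ℝ := Real.exp (lam * V) - 1

/-- `huber(x, y) = x² / 2 - (|x| - |y|)₊² / 2`. -/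
noncomputable def huber (x y : ℝ) : ℝ := x ^ 2 / 2 - (max (|x| - |y|) 0) ^ 2 / 2

namespace Problem

variable {d : ℕ}

/-- The standing assumptions: a closed convex bounded decision set; losses and constraints that are
bounded by `F` and `G` on `X^{m+1}` and Lipschitz with constants `Lf` and `Lg` for the `ℓ₂` norm on
`(ℝ^d)^{m+1}`; no loss and no constraint outside the rounds `m + 1, …, T`. -/
structure Assumptions (P : Problem d) (F G Lf Lg : ℝ) : Prop where
  closed : IsClosed P.X
  convex : Convex ℝ P.X
  bounded : Bornology.IsBounded P.X
  f_bdd : ∀ t ∈ Finset.Icc P.m P.T, ∀ y : ℕ → Space d, (∀ i ≤ P.m, y i ∈ P.X) →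
    |memVal P.m (P.f t) y| ≤ F
  g_bdd : ∀ t ∈ Finset.Icc P.m P.T, ∀ y : ℕ → Space d, (∀ i ≤ P.m, y i ∈ P.X) →
    |memVal P.m (P.g t) y| ≤ G
  f_lip : ∀ t ∈ Finset.Icc P.m P.T, ∀ y z : ℕ → Space d,
    |memVal P.m (P.f t) y - memVal P.m (P.f t) z| ≤
      Lf * √(∑ i ∈ Finset.range (P.m + 1), ‖y i - z i‖ ^ 2)
  g_lip : ∀ t ∈ Finset.Icc P.m P.T, ∀ y z : ℕ → Space d,
    |memVal P.m (P.g t) y - memVal P.m (P.g t) z| ≤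
      Lg * √(∑ i ∈ Finset.range (P.m + 1), ‖y i - z i‖ ^ 2)
  f_zero : ∀ t, t ≤ P.m ∨ P.T < t → ∀ i, P.f t i = ⟨0, 0⟩
  g_zero : ∀ t, t ≤ P.m ∨ P.T < t → ∀ i, P.g t i = ⟨0, 0⟩

/-- The benchmark set `X_T^{mp}`. -/
def benchmark (P : Problem d) : Set (Space d) :=
  {u | u ∈ P.X ∧ ∀ t ∈ Finset.Icc P.m P.T, ∀ i ≤ P.m, (P.g t i).eval u ≤ 0}

/-- `f_t(x_{t-m}, …, x_t)` for the decisions `x`. -/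
noncomputable def lossAt (P : Problem d) (x : ℕ → Space d) (t : ℕ) : ℝ :=
  memVal P.m (P.f t) (fun i => x (t - i))

/-- `g_t(x_{t-m}, …, x_t)` for the decisions `x`. -/
noncomputable def constrAt (P : Problem d) (x : ℕ → Space d) (t : ℕ) : ℝ :=
  memVal P.m (P.g t) (fun i => x (t - i))

/-- The regret `R_T^{mc}` against the best fixed decision in the benchmark set. -/
noncomputable def regret (P : Problem d) (x : ℕ → Space d) : ℝ :=
  ∑ t ∈ Finset.Icc P.m P.T, P.lossAt x t -
    sInf ((fun u => ∑ t ∈ Finset.Icc P.m P.T, P.lossAt (fun _ => u) t) '' P.benchmark)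

/-- The cumulative constraint violation `V_t`, with `V_t = 0` for `t < m`. -/
noncomputable def violation (P : Problem d) (x : ℕ → Space d) (t : ℕ) : ℝ :=
  ∑ k ∈ Finset.Icc P.m t, max (P.constrAt x k) 0

end Problem

namespace Run

variable {d : ℕ}

/-- The multiplier `Φ'(V_{k-m-1})` of the constraint components of round `k`. For `k ≤ m` the
truncated difference gives `Φ'(V_0)`, and `V_0 = 0` under the standing assumptions. -/
noncomputable def weight (R : Run d) (P : Problem d) (k : ℕ) : ℝ :=
  deriv (penalty R.lam) (P.violation R.x (k - P.m - 1))

/-- The gradient `∇Z_s(x_s)` of the forward function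
`Z_s(x) = ∑_{i ≤ m} f_{s+i}^i(x) + Φ'(V_{s-m-1+i}) g_{s+i}^{i,+}(x)`. -/
noncomputable def gradZ (R : Run d) (P : Problem d) (s : ℕ) : Space d :=
  ∑ i ∈ Finset.range (P.m + 1), ((P.f (s + i) i).slope + R.weight P (s + i) • R.gradG s i)

/-- The hint `h_t`, an estimate of `∇Z_{t-m} + ⋯ + ∇Z_t`: a slice of `Z_s` that belongs to a round
`s + i < t` is known when `x_t` is chosen, the others are replaced by their forecasts. -/
noncomputable def hint (R : Run d) (P : Problem d) (t : ℕ) : Space d :=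
  ∑ s ∈ Finset.Icc (t - P.m) t, ∑ i ∈ Finset.range (P.m + 1),
    if s + i < t then (P.f (s + i) i).slope + R.weight P (s + i) • R.gradG s i
    else R.predF t s i + R.weight P (s + i) • R.predG t s i

/-- The size `‖h_t - ∇Z_{t-m:t}‖` of the error of the hint. -/
noncomputable def hintErr (R : Run d) (P : Problem d) (t : ℕ) : ℝ :=
  ‖R.hint P t - ∑ s ∈ Finset.Icc (t - P.m) t, R.gradZ P s‖

/-- `a_t = ‖X‖ min(‖h_t - ∇Z_{t-m:t}‖, ‖∇Z_t‖)`. -/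
noncomputable def aTerm (R : Run d) (P : Problem d) (t : ℕ) : ℝ :=
  Metric.diam P.X * min (R.hintErr P t) ‖R.gradZ P t‖

/-- `b_t = huber(‖h_t - ∇Z_{t-m:t}‖, ‖∇Z_t‖)`. -/
noncomputable def bTerm (R : Run d) (P : Problem d) (t : ℕ) : ℝ :=
  huber (R.hintErr P t) ‖R.gradZ P t‖

/-- `muNext t` is the weight `μ_{t+1}` of the regularizer, i.e.
`(2/α) max_{j ≤ t-m-1} a_{j-m+1:j} + (1/α) √(∑_{i=1}^{t-m} (a_i² + 2 α b_i))`.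
Here `a_0 = 0`, because `Z_0 = 0` under the standing assumptions. -/
noncomputable def muNext (R : Run d) (P : Problem d) (t : ℕ) : ℝ :=
  2 / R.α * (Finset.range (t - P.m - 1 + 1)).sup' Finset.nonempty_range_add_one
      (fun j => ∑ k ∈ Finset.Icc (j + 1 - P.m) j, R.aTerm P k) +
    1 / R.α * √(∑ i ∈ Finset.Icc 1 (t - P.m), (R.aTerm P i ^ 2 + 2 * R.α * R.bTerm P i))

/-- The objective that the learner minimizes over `X` to find the decision of round `t + 1`. -/
noncomputable def objNext (R : Run d) (P : Problem d) (t : ℕ) (y : Space d) : ℝ :=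
  ⟪∑ s ∈ Finset.Icc 1 (t - P.m), R.gradZ P s + R.hint P (t + 1), y⟫ + R.muNext P t * R.r y

/-- `R` is a run of the optimistic delayed adaptive FTRL algorithm on the forward functions of `P`,
with an arbitrary initial history, arbitrary forecasts of norm at most `Lf` and `Lg`, and a
nonnegative regularizer that is `1`-strongly convex and bounded by `ρ` on `X`. -/
structure IsODAF (R : Run d) (P : Problem d) (Lf Lg ρ : ℝ) : Prop where
  strong : StrongConvexOn P.X 1 R.r
  r_nonneg : ∀ y ∈ P.X, 0 ≤ R.r y
  r_le : ∀ y ∈ P.X, R.r y ≤ ρ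
  mem : ∀ t ≤ P.T, R.x t ∈ P.X
  subgrad : ∀ s ≤ P.T, ∀ i ≤ P.m,
    IsSubgradientAt (fun y => max ((P.g (s + i) i).eval y) 0) (R.gradG s i) (R.x s)
  predF_le : ∀ t s i, ‖R.predF t s i‖ ≤ Lf
  predG_le : ∀ t s i, ‖R.predG t s i‖ ≤ Lg
  update : ∀ t, P.m + 1 ≤ t → t + 1 ≤ P.T → IsMinOn (R.objNext P t) P.X (R.x (t + 1))

/-- The loss prediction error `ε_t(f)`: the slices of `Z_{t-m}, …, Z_t` that are still unknown when
`x_t` is chosen are those with `i ≥ t - s`. -/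
noncomputable def epsF (R : Run d) (P : Problem d) (t : ℕ) : ℝ :=
  ‖∑ s ∈ Finset.Icc (t - P.m) t, ∑ i ∈ Finset.Icc (t - s) P.m,
    (R.predF t s i - (P.f (s + i) i).slope)‖ ^ 2

/-- The constraint prediction error `ε_t(g⁺)`. As for the losses, but slices of different rounds
`s + i` carry different multipliers, so the error is the largest one over the tails `s + i ≥ t + j`,
`0 ≤ j ≤ m`, of the unknown slices; `j = 0` gives all of them. -/
noncomputable def epsG (R : Run d) (P : Problem d) (t : ℕ) : ℝ :=
  (Finset.range (P.m + 1)).sup' Finset.nonempty_range_add_one (fun j =>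
    ‖∑ s ∈ Finset.Icc (t - P.m) t, ∑ i ∈ Finset.Icc (t + j - s) P.m,
      (R.predG t s i - R.gradG s i)‖ ^ 2)

/-- The cumulative error `E_T(f)`. -/
noncomputable def errF (R : Run d) (P : Problem d) : ℝ :=
  ∑ t ∈ Finset.Icc P.m P.T, R.epsF P t

/-- The cumulative error `E_T(g⁺)`. -/
noncomputable def errG (R : Run d) (P : Problem d) : ℝ :=
  ∑ t ∈ Finset.Icc P.m P.T, R.epsG P t

end Run

/-- The constant `√2 (ρ/α + 1) (2 m D + √(D² + α))` of the regret bound, where `D` is the diameter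
of `X` and `ρ` bounds the regularizer. -/
noncomputable def regretConst (m : ℕ) (D α ρ : ℝ) : ℝ :=
  √2 * (ρ / α + 1) * (2 * m * D + √(D ^ 2 + α))

end CocoMemory

/-! Linearized regret of the forward functions. The delayed method is undelayed optimistic FTRL in
disguise: subtracting from `h_t` the `m` gradients that have not yet entered the sum leaves a hint
for `∇Z_t` alone, with the same error `e_t`. A potential argument charges to each round a drift
`δ_t` with `δ_t ≤ a_t` and `μ_t δ_t ≤ b_t` (`exists_drift`, `ftrl_telescope`). Since `μ_t` reflects
data that are `m` rounds old, expanding the square of the sum of drifts closes the recursion up to a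
window of `m` drifts, and the maximum in `μ_t` pays for that window (`sum_drift_le_delayedBound`).
The linearized regret is thus at most `C₀ / √2` times `√(∑ e_t²)`, plus a constant.

Hint errors. The multipliers `w_k` are nondecreasing, so summation by parts over the tails of
unknown slices gives `e_t ≤ √ε_t(f) + w_{t+m} √ε_t(g⁺)` (`hintErr_le`), where `w_{t+m} ≤ λ exp(λ
V_T)`.

Absorption. The linearized regret dominates the regret plus `∑ w_k g_k⁺`, because benchmark points
annihilate every `g_t^{i,+}`. In `m + 1` rounds `V` grows by at most `G (m+1)`, and `λ G (m+1) ≤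
1/2`, so the delayed multipliers still give `∑ w_k g_k⁺ ≥ exp(-1/2) (exp(λ V_T) - 1)`. The choice of
`λ` also makes `C₀ λ √E_T(g⁺) ≤ 1/2 < exp(-1/2)`, hence the exponential on the right is absorbed and
regret plus `exp(λ V_T) / 10` is at most `C₀ √E_T(f) + A_m` (`regret_add_exp_violation_le`).
Dropping the exponential bounds the regret. Since the regret is at least `-2F(T+1)` and the right
side is polynomial in `T`, also `λ V_T = O(log T)`; division by `λ` bounds the violation. -/

namespace CocoMemory

/-! ### One-step drift of optimistic FTRL -/

section FTRL

variable {E : Type*} [NormedAddCommGroup E] [InnerProductSpace ℝ E]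

theorem strongConvexOn_comb {X : Set E} {ψ : E → ℝ} (hψ : StrongConvexOn X 1 ψ) {μ : ℝ}
    (hμ : 0 ≤ μ) (c : E) {v w : E} (hv : v ∈ X) (hw : w ∈ X) {τ : ℝ} (h0 : 0 ≤ τ) (h1 : τ ≤ 1) :
    ⟪c, τ • v + (1 - τ) • w⟫ + μ * ψ (τ • v + (1 - τ) • w) ≤
      τ * (⟪c, v⟫ + μ * ψ v) + (1 - τ) * (⟪c, w⟫ + μ * ψ w)
        - τ * (1 - τ) * (μ / 2 * ‖w - v‖ ^ 2) := by
  have h := hψ.2 hv hw h0 (sub_nonneg.2 h1) (by ring)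
  simp only [smul_eq_mul] at h
  rw [norm_sub_rev] at h
  have := mul_le_mul_of_nonneg_left h hμ
  rw [inner_add_right, inner_smul_right, inner_smul_right]
  linarith

/-- Quadratic growth of a regularized linear objective at its minimizer. -/
theorem quadratic_growth_of_isMinOn {X : Set E} {ψ : E → ℝ} (hψ : StrongConvexOn X 1 ψ) {μ : ℝ}
    (hμ : 0 ≤ μ) {c v : E} (hv : v ∈ X) (hmin : IsMinOn (fun y => ⟪c, y⟫ + μ * ψ y) X v)
    {w : E} (hw : w ∈ X) :
    ⟪c, v⟫ + μ * ψ v + μ / 2 * ‖w - v‖ ^ 2 ≤ ⟪c, w⟫ + μ * ψ w := by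
  set q := μ / 2 * ‖w - v‖ ^ 2 with hq
  have hq0 : 0 ≤ q := by positivity
  by_contra! hlt
  set η := ⟪c, v⟫ + μ * ψ v + q - (⟪c, w⟫ + μ * ψ w) with hη
  have hη0 : 0 < η := by rw [hη]; linarith
  -- a step of size `θ` from `v` towards `w`
  set θ := min 1 (η / (2 * (q + 1))) with hθ
  have hθ0 : 0 < θ := lt_min one_pos (by positivity)
  have hθ1 : θ ≤ 1 := min_le_left _ _
  have hθq : θ * q < η := by
    have h1 : θ * q ≤ η / (2 * (q + 1)) * q := mul_le_mul_of_nonneg_right (min_le_right _ _) hq0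
    have h2 : η / (2 * (q + 1)) * q < η := by
      rw [div_mul_eq_mul_div, div_lt_iff₀ (by positivity)]
      nlinarith
    linarith
  -- The step gains `θ * η` and loses only `θ ^ 2 * q`, against minimality of `v`.
  have h := strongConvexOn_comb hψ hμ c hv hw (τ := 1 - θ) (by linarith) (by linarith)
  have hy : (1 - θ) • v + (1 - (1 - θ)) • w ∈ X :=
    hψ.1 hv hw (by linarith) (by linarith) (by ring)
  have hm := hmin hy
  simp only [Set.mem_ofPred_eq] at hm
  rw [← hq] at h
  have h3 : θ * (η - θ * q) ≤ 0 := by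
    rw [hη]
    linarith
  nlinarith [mul_pos hθ0 (sub_pos.2 hθq)]

theorem huber_eq_of_le {e γ : ℝ} (he : 0 ≤ e) (hγ : e ≤ γ) : huber e γ = e ^ 2 / 2 := by
  have hγ0 := he.trans hγ
  rw [huber, abs_of_nonneg he, abs_of_nonneg hγ0, max_eq_right (by linarith)]
  ring

theorem huber_eq_of_ge {e γ : ℝ} (hγ : 0 ≤ γ) (he : γ ≤ e) :
    huber e γ = γ * (2 * e - γ) / 2 := by
  have he0 := hγ.trans he
  rw [huber, abs_of_nonneg he0, abs_of_nonneg hγ, max_eq_left (by linarith)]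
  ring

theorem huber_nonneg {e γ : ℝ} (he : 0 ≤ e) (hγ : 0 ≤ γ) : 0 ≤ huber e γ := by
  rcases le_total e γ with h | h
  · rw [huber_eq_of_le he h]; positivity
  · rw [huber_eq_of_ge hγ h]
    have : 0 ≤ 2 * e - γ := by linarith
    positivity

theorem huber_le (e γ : ℝ) : huber e γ ≤ e ^ 2 / 2 := by
  have : 0 ≤ (max (|e| - |γ|) 0) ^ 2 / 2 := by positivity
  rw [huber]; linarith

/-- The drift of one step is at most `diam X * min(e, ‖g‖)`, where `e` is the error of the hint. -/
theorem exists_drift_le_diam {X : Set E} {ψ : E → ℝ} (hb : Bornology.IsBounded X) {μ : ℝ}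
    {c p g v : E} (hv : v ∈ X) (hmin : IsMinOn (fun y => ⟪c + p, y⟫ + μ * ψ y) X v)
    {w : E} (hw : w ∈ X) :
    ∃ y ∈ X, ⟪g, v⟫ + (⟪c, y⟫ + μ * ψ y) ≤
      ⟪c + g, w⟫ + μ * ψ w + Metric.diam X * min ‖p - g‖ ‖g‖ := by
  have hd : ‖w - v‖ ≤ Metric.diam X := by
    rw [← dist_eq_norm]; exact Metric.dist_le_diam_of_mem hb hw hv
  -- With a good hint, `v` is kept and the hint error is paid; with a bad one, `w` is taken and the
  -- full gradient is paid.
  rcases le_total ‖p - g‖ ‖g‖ with h | h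
  · refine ⟨v, hv, ?_⟩
    rw [min_eq_left h]
    have hm := hmin hw
    simp only [Set.mem_ofPred_eq, inner_add_left] at hm
    have h1 : ⟪p - g, w - v⟫ ≤ Metric.diam X * ‖p - g‖ := by
      refine (real_inner_le_norm _ _).trans ?_
      rw [mul_comm]
      exact mul_le_mul_of_nonneg_right hd (norm_nonneg _)
    simp only [inner_sub_left, inner_sub_right] at h1
    rw [inner_add_left]
    linarith
  · refine ⟨w, hw, ?_⟩
    rw [min_eq_right h]
    have h1 : ⟪-g, w - v⟫ ≤ Metric.diam X * ‖g‖ := by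
      refine (real_inner_le_norm _ _).trans ?_
      rw [mul_comm, norm_neg]
      exact mul_le_mul_of_nonneg_right hd (norm_nonneg _)
    simp only [inner_neg_left, inner_sub_right] at h1
    rw [inner_add_left]
    linarith

/-- The drift of one step is at most `huber(e, ‖g‖) / μ`, where `e` is the error of the hint. -/
theorem exists_drift_le_huber {X : Set E} {ψ : E → ℝ} (hψ : StrongConvexOn X 1 ψ) {μ : ℝ}
    (hμ : 0 < μ) {c p g v : E} (hv : v ∈ X)
    (hmin : IsMinOn (fun y => ⟪c + p, y⟫ + μ * ψ y) X v) {w : E} (hw : w ∈ X) :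
    ∃ y ∈ X, ⟪g, v⟫ + (⟪c, y⟫ + μ * ψ y) ≤
      ⟪c + g, w⟫ + μ * ψ w + huber ‖p - g‖ ‖g‖ / μ := by
  set e := ‖p - g‖ with he
  set γ := ‖g‖ with hγ
  have he0 : 0 ≤ e := norm_nonneg _
  have hγ0 : 0 ≤ γ := norm_nonneg _
  -- `τ = min(1, γ/e)`: interpolating between `v` and `w` produces the two regimes of `huber`.
  obtain ⟨τ, hτ0, hτ1, hτe, hτh⟩ : ∃ τ : ℝ, 0 ≤ τ ∧ τ ≤ 1 ∧ (1 - τ) * γ ≤ (1 - τ) * (τ * e) ∧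
      huber e γ = τ * (2 - τ) * e ^ 2 / 2 := by
    rcases le_total e γ with h | h
    · exact ⟨1, zero_le_one, le_rfl, by simp, by rw [huber_eq_of_le he0 h]; ring⟩
    · rcases he0.eq_or_lt with h0 | h0
      · have : γ = 0 := by linarith
        exact ⟨1, zero_le_one, le_rfl, by simp, by
          rw [huber_eq_of_ge hγ0 h, this, ← h0]; ring⟩
      · refine ⟨γ / e, by positivity, (div_le_one h0).2 h, ?_, ?_⟩
        · rw [div_mul_cancel₀ _ h0.ne']
        · rw [huber_eq_of_ge hγ0 h]; field_simp
  refine ⟨τ • v + (1 - τ) • w, hψ.1 hv hw hτ0 (by linarith) (by ring), ?_⟩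
  have hgrow := quadratic_growth_of_isMinOn hψ hμ.le hv hmin hw
  have hcomb := strongConvexOn_comb hψ hμ.le c hv hw hτ0 hτ1
  set n := ‖w - v‖ with hn
  have hn0 : 0 ≤ n := norm_nonneg _
  have h1 : ⟪p - g, w - v⟫ ≤ e * n := real_inner_le_norm _ _
  have h2 : -⟪g, w - v⟫ ≤ γ * n := by
    rw [← inner_neg_left, hγ, ← norm_neg]; exact real_inner_le_norm _ _
  simp only [inner_add_left, inner_sub_left, inner_sub_right] at hgrow h1 h2 ⊢
  -- Growth contributes `τ` and strong convexity `τ (1 - τ)` to the quadratic term; the sum is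
  -- maximal at `n = e / μ`.
  have hquad : τ * (2 - τ) * (e * n) - μ / 2 * (τ * (2 - τ)) * n ^ 2 ≤ huber e γ / μ := by
    rw [hτh, le_div_iff₀ hμ]
    have : 0 ≤ τ * (2 - τ) * (e - μ * n) ^ 2 :=
      mul_nonneg (mul_nonneg hτ0 (by linarith)) (sq_nonneg _)
    linarith
  have h3 := mul_le_mul_of_nonneg_left hgrow hτ0
  have h4 := mul_le_mul_of_nonneg_left h1 hτ0
  have h5 := mul_le_mul_of_nonneg_left h2 (sub_nonneg.2 hτ1)
  have h6 := mul_le_mul_of_nonneg_right hτe hn0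
  linarith

/-- A single `δ` has to meet both bounds, so the smaller one is taken. The form "for all `w` some
`y`" stands in for minima of the potentials, which need not be attained. -/
theorem exists_drift {X : Set E} {ψ : E → ℝ} (hψ : StrongConvexOn X 1 ψ)
    (hb : Bornology.IsBounded X) {μ : ℝ} (hμ : 0 ≤ μ) {c p g v : E} (hv : v ∈ X)
    (hmin : IsMinOn (fun y => ⟪c + p, y⟫ + μ * ψ y) X v) :
    ∃ δ : ℝ, 0 ≤ δ ∧ δ ≤ Metric.diam X * min ‖p - g‖ ‖g‖ ∧ μ * δ ≤ huber ‖p - g‖ ‖g‖ ∧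
      ∀ w ∈ X, ∃ y ∈ X, ⟪g, v⟫ + (⟪c, y⟫ + μ * ψ y) ≤ ⟪c + g, w⟫ + μ * ψ w + δ := by
  have ha : 0 ≤ Metric.diam X * min ‖p - g‖ ‖g‖ :=
    mul_nonneg Metric.diam_nonneg (le_min (norm_nonneg _) (norm_nonneg _))
  have hh := huber_nonneg (norm_nonneg (p - g)) (norm_nonneg g)
  rcases hμ.eq_or_lt with h0 | h0
  · exact ⟨_, ha, le_rfl, by rw [← h0, zero_mul]; exact hh,
      fun w hw => exists_drift_le_diam hb hv hmin hw⟩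
  · rcases le_total (huber ‖p - g‖ ‖g‖ / μ) (Metric.diam X * min ‖p - g‖ ‖g‖) with h | h
    · exact ⟨_, by positivity, h, (mul_div_cancel₀ _ h0.ne').le,
        fun w hw => exists_drift_le_huber hψ h0 hv hmin hw⟩
    · exact ⟨_, ha, le_rfl, by rw [mul_comm]; exact (le_div_iff₀ h0).1 h,
        fun w hw => exists_drift_le_diam hb hv hmin hw⟩

/-- Telescoping of the drifts of optimistic FTRL with a nondecreasing regularization weight. -/
theorem ftrl_telescope {X : Set E} {ψ : E → ℝ} (hψ0 : ∀ y ∈ X, 0 ≤ ψ y) {z x : ℕ → E}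
    {μ δ : ℕ → ℝ} {t₀ T : ℕ} (hT : t₀ + 1 ≤ T) (hmono : Monotone μ) {κ : ℝ}
    (hκ : ∀ y ∈ X, κ ≤ ⟪∑ s ∈ Finset.Icc 1 t₀, z s, y⟫ + μ (t₀ + 1) * ψ y)
    (hδ : ∀ t, t₀ + 1 ≤ t → t ≤ T → ∀ w ∈ X, ∃ y ∈ X,
      ⟪z t, x t⟫ + (⟪∑ s ∈ Finset.Icc 1 (t - 1), z s, y⟫ + μ t * ψ y) ≤
        ⟪∑ s ∈ Finset.Icc 1 (t - 1), z s + z t, w⟫ + μ t * ψ w + δ t)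
    {w : E} (hw : w ∈ X) :
    ∑ t ∈ Finset.Icc (t₀ + 1) T, ⟪z t, x t⟫ + κ ≤
      ⟪∑ s ∈ Finset.Icc 1 T, z s, w⟫ + μ T * ψ w + ∑ t ∈ Finset.Icc (t₀ + 1) T, δ t := by
  induction T, hT using Nat.le_induction generalizing w with
  | base =>
    obtain ⟨y, hy, h⟩ := hδ (t₀ + 1) le_rfl le_rfl w hw
    have := hκ y hy
    simp only [Nat.add_sub_cancel] at h
    rw [Finset.Icc_self, Finset.sum_singleton, Finset.sum_singleton,
      Finset.sum_Icc_succ_top (by omega)]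
    linarith
  | succ T hT ih =>
    obtain ⟨y, hy, h⟩ := hδ (T + 1) (by omega) le_rfl w hw
    have h1 := ih (fun t h1 h2 => hδ t h1 (by omega)) hy
    have h2 := mul_le_mul_of_nonneg_right (hmono (Nat.le_succ T)) (hψ0 y hy)
    simp only [Nat.add_sub_cancel, Nat.succ_eq_add_one] at h h2
    rw [Finset.sum_Icc_succ_top (by omega), Finset.sum_Icc_succ_top (by omega),
      Finset.sum_Icc_succ_top (f := δ) (by omega)]
    linarith

end FTRL

/-! ### Summing drifts under delayed weights -/

/-- `2 max_{j < t} a_{j-m+1:j} + √(∑_{i=1}^{t} (a_i² + 2 α b_i))`. -/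
noncomputable def delayedBound (m : ℕ) (α : ℝ) (a b : ℕ → ℝ) (t : ℕ) : ℝ :=
  2 * (Finset.range (t - 1 + 1)).sup' Finset.nonempty_range_add_one
      (fun j => ∑ k ∈ Finset.Icc (j + 1 - m) j, a k) +
    √(∑ i ∈ Finset.Icc 1 t, (a i ^ 2 + 2 * α * b i))

theorem delayedBound_mono {m : ℕ} {α : ℝ} {a b : ℕ → ℝ} (hα : 0 ≤ α) (hb : ∀ t, 0 ≤ b t) :
    Monotone (delayedBound m α a b) := by
  intro s t hst
  refine add_le_add (mul_le_mul_of_nonneg_left (Finset.sup'_mono _ ?_ _) zero_le_two)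
    (Real.sqrt_le_sqrt (Finset.sum_le_sum_of_subset_of_nonneg ?_ ?_))
  · exact Finset.range_mono (by omega)
  · exact Finset.Icc_subset_Icc le_rfl hst
  · intro i _ _
    have := hb i
    positivity

theorem sup'_window_nonneg {m n : ℕ} {a : ℕ → ℝ} (ha : ∀ t, 0 ≤ a t) :
    0 ≤ (Finset.range (n + 1)).sup' Finset.nonempty_range_add_one
      (fun j => ∑ k ∈ Finset.Icc (j + 1 - m) j, a k) :=
  (Finset.sum_nonneg fun k _ => ha k).trans
    (Finset.le_sup' (fun j => ∑ k ∈ Finset.Icc (j + 1 - m) j, a k)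
      (Finset.mem_range.2 (Nat.succ_pos n)))

theorem delayedBound_nonneg {m : ℕ} {α : ℝ} {a b : ℕ → ℝ} (ha : ∀ t, 0 ≤ a t) (t : ℕ) :
    0 ≤ delayedBound m α a b t :=
  add_nonneg (mul_nonneg zero_le_two (sup'_window_nonneg ha)) (Real.sqrt_nonneg _)

/-- The drifts of a delayed adaptive method sum up to at most the delayed bound. -/
theorem sum_drift_le_delayedBound {m T : ℕ} {α : ℝ} {a b δ : ℕ → ℝ} (hα : 0 ≤ α)
    (ha : ∀ t, 0 ≤ a t) (hb : ∀ t, 0 ≤ b t) (hδ0 : ∀ t, 0 ≤ δ t) (hδa : ∀ t, δ t ≤ a t)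
    (hδinit : ∀ t ≤ m + 1, δ t = 0)
    (hδb : ∀ t, m + 2 ≤ t → t ≤ T → δ t * delayedBound m α a b (t - 1 - m) ≤ α * b t) :
    ∀ t ≤ T, ∑ s ∈ Finset.Icc 1 t, δ s ≤ delayedBound m α a b t := by
  intro t
  induction t using Nat.strong_induction_on with
  | _ t IH =>
  intro ht
  set M := (Finset.range (t - 1 + 1)).sup' Finset.nonempty_range_add_one
      (fun j => ∑ k ∈ Finset.Icc (j + 1 - m) j, a k) with hM
  have hM0 : 0 ≤ M := sup'_window_nonneg ha
  set A : ℕ → ℝ := fun n => ∑ s ∈ Finset.Icc 1 n, δ s with hA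
  set S : ℕ → ℝ := fun n => ∑ i ∈ Finset.Icc 1 n, (a i ^ 2 + 2 * α * b i) with hS
  have hA0 : ∀ n, 0 ≤ A n := fun n => Finset.sum_nonneg fun s _ => hδ0 s
  -- In `A (n+1) ^ 2 = A n ^ 2 + 2 δ A n + δ ^ 2`, the part `A (n - m)` of `A n` is paid by the
  -- delayed weight through `b`, the rest by `M`.
  have key : ∀ n ≤ t, A n ^ 2 ≤ S n + 2 * M * A n := by
    intro n
    induction n with
    | zero => intro _; simp [hA, hS]
    | succ n ih =>
      intro hn
      have ih := ih (by omega)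
      have hAs : A (n + 1) = A n + δ (n + 1) := Finset.sum_Icc_succ_top (by omega) _
      have hSs : S (n + 1) = S n + (a (n + 1) ^ 2 + 2 * α * b (n + 1)) :=
        Finset.sum_Icc_succ_top (by omega) _
      have hb1 := mul_nonneg hα (hb (n + 1))
      by_cases hnm : n + 1 ≤ m + 1
      · rw [hAs, hSs, hδinit _ hnm, add_zero]
        nlinarith [sq_nonneg (a (n + 1))]
      · have hwin : A n - A (n - m) ≤ M := by
          have hsplit : A n = A (n - m) + ∑ s ∈ Finset.Icc (n + 1 - m) n, δ s := by
            have := Finset.sum_Ioc_consecutive δ (Nat.zero_le (n - m)) (Nat.sub_le n m)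
            have e1 : Finset.Icc 1 n = Finset.Ioc 0 n := rfl
            have e2 : Finset.Icc 1 (n - m) = Finset.Ioc 0 (n - m) := rfl
            have e3 : Finset.Icc (n + 1 - m) n = Finset.Ioc (n - m) n := by
              ext k; simp only [Finset.mem_Icc, Finset.mem_Ioc]; omega
            simp only [hA]
            rw [e1, e2, e3, this]
          have h1 : ∑ s ∈ Finset.Icc (n + 1 - m) n, δ s ≤ ∑ s ∈ Finset.Icc (n + 1 - m) n, a s :=
            Finset.sum_le_sum fun s _ => hδa s
          have h2 : ∑ s ∈ Finset.Icc (n + 1 - m) n, a s ≤ M :=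
            Finset.le_sup' (fun j => ∑ k ∈ Finset.Icc (j + 1 - m) j, a k)
              (Finset.mem_range.2 (by omega))
          linarith
        have hprev : A (n - m) ≤ delayedBound m α a b (n - m) := IH _ (by omega) (by omega)
        have hdb := hδb (n + 1) (by omega) (by omega)
        simp only [Nat.add_sub_cancel] at hdb
        have h3 := mul_le_mul_of_nonneg_left hprev (hδ0 (n + 1))
        have h4 := mul_le_mul_of_nonneg_left hwin (hδ0 (n + 1))
        have h5 : δ (n + 1) ^ 2 ≤ a (n + 1) ^ 2 := pow_le_pow_left₀ (hδ0 _) (hδa _) 2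
        rw [hAs, hSs]
        nlinarith
  have hS0 : 0 ≤ S t := Finset.sum_nonneg fun i _ => by
    have := hb i
    positivity
  have hk := key t le_rfl
  have hsq := Real.sq_sqrt hS0
  have hs0 := Real.sqrt_nonneg (S t)
  change A t ≤ 2 * M + √(S t)
  by_contra! hlt
  nlinarith [mul_pos (sub_pos.2 hlt) (lt_of_le_of_lt (by positivity) hlt : 0 < A t),
    mul_nonneg hM0 hs0]

/-- A window has at most `m` terms, each at most `Δ` times the root of the sum; the other summand
uses `a ^ 2 + 2 α b ≤ (Δ ^ 2 + α) e ^ 2`. -/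
theorem delayedBound_le {m T : ℕ} {α Δ : ℝ} {a b e : ℕ → ℝ} (hα : 0 ≤ α) (hΔ : 0 ≤ Δ)
    (ha0 : ∀ t, 0 ≤ a t) (ha : ∀ t, a t ≤ Δ * e t) (hb : ∀ t, b t ≤ e t ^ 2 / 2) :
    delayedBound m α a b T ≤
      (2 * m * Δ + √(Δ ^ 2 + α)) * √(∑ t ∈ Finset.range (T + 1), e t ^ 2) := by
  set N := √(∑ t ∈ Finset.range (T + 1), e t ^ 2) with hN
  have hN0 : 0 ≤ N := Real.sqrt_nonneg _
  have heN : ∀ t ≤ T, e t ≤ N := fun t ht => Real.le_sqrt_of_sq_le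
    (Finset.single_le_sum (f := fun t => e t ^ 2) (fun i _ => sq_nonneg _)
      (Finset.mem_range.2 (by omega)))
  have hsup : (Finset.range (T - 1 + 1)).sup' Finset.nonempty_range_add_one
      (fun j => ∑ k ∈ Finset.Icc (j + 1 - m) j, a k) ≤ m * (Δ * N) := by
    refine Finset.sup'_le _ _ fun j hj => ?_
    have hj' := Finset.mem_range.1 hj
    refine (Finset.sum_le_card_nsmul _ _ (Δ * N) fun k hk => ?_).trans ?_
    · have hk' := Finset.mem_Icc.1 hk
      exact (ha k).trans (mul_le_mul_of_nonneg_left (heN k (by omega)) hΔ)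
    · rw [nsmul_eq_mul, Nat.card_Icc]
      refine mul_le_mul_of_nonneg_right ?_ (by positivity)
      exact_mod_cast (by omega : j + 1 - (j + 1 - m) ≤ m)
  have hsqrt : √(∑ i ∈ Finset.Icc 1 T, (a i ^ 2 + 2 * α * b i)) ≤ √(Δ ^ 2 + α) * N := by
    rw [hN, ← Real.sqrt_mul (by positivity)]
    refine Real.sqrt_le_sqrt ?_
    rw [Finset.mul_sum]
    refine (Finset.sum_le_sum fun i _ => ?_).trans (Finset.sum_le_sum_of_subset_of_nonneg
      (f := fun i => (Δ ^ 2 + α) * e i ^ 2) (fun i hi => ?_) fun i _ _ => by positivity)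
    · have h1 : a i ^ 2 ≤ (Δ * e i) ^ 2 := pow_le_pow_left₀ (ha0 i) (ha i) 2
      have h2 := mul_le_mul_of_nonneg_left (hb i) hα
      linarith [mul_pow Δ (e i) 2]
    · have := Finset.mem_Icc.1 hi
      exact Finset.mem_range.2 (by omega)
  rw [delayedBound]
  linarith

/-! ### Gradient bounds and the violation -/

variable {d : ℕ}

/-- The Lipschitz bound is tested with the slope itself in slot `i` and zero elsewhere. -/
theorem slope_norm_le {m : ℕ} {φ : ℕ → LinFun d} {L : ℝ} (hL : 0 ≤ L)
    (h : ∀ y z : ℕ → Space d, |memVal m φ y - memVal m φ z| ≤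
      L * √(∑ i ∈ Finset.range (m + 1), ‖y i - z i‖ ^ 2)) {i : ℕ} (hi : i ≤ m) :
    ‖(φ i).slope‖ ≤ L := by
  have hmem : i ∈ Finset.range (m + 1) := Finset.mem_range.2 (by omega)
  have h1 := h (Function.update 0 i (φ i).slope) 0
  have h2 : memVal m φ (Function.update 0 i (φ i).slope) - memVal m φ 0 = ‖(φ i).slope‖ ^ 2 := by
    rw [memVal, memVal, ← Finset.sum_sub_distrib, Finset.sum_eq_single_of_mem i hmem]
    · simp [LinFun.eval]
    · intro j _ hj
      simp [Function.update_of_ne hj]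
  have h3 : ∑ j ∈ Finset.range (m + 1),
      ‖Function.update (0 : ℕ → Space d) i (φ i).slope j - (0 : ℕ → Space d) j‖ ^ 2 =
        ‖(φ i).slope‖ ^ 2 := by
    rw [Finset.sum_eq_single_of_mem i hmem]
    · simp
    · intro j _ hj
      simp [Function.update_of_ne hj]
  rw [h2, h3, Real.sqrt_sq (norm_nonneg _), abs_of_nonneg (by positivity)] at h1
  rcases (norm_nonneg (φ i).slope).eq_or_lt with h0 | h0
  · rw [← h0]; exact hL
  · nlinarith

theorem LinFun.eval_sub (φ : LinFun d) (x y : Space d) :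
    φ.eval x - φ.eval y = ⟪φ.slope, x - y⟫ := by
  rw [LinFun.eval, LinFun.eval, inner_sub_right]; ring

/-- Testing the subgradient inequality at `x + v` gives `‖v‖ ^ 2 ≤ ‖φ.slope‖ * ‖v‖`. -/
theorem IsSubgradientAt.norm_le {φ : LinFun d} {v x : Space d}
    (h : IsSubgradientAt (fun y => max (φ.eval y) 0) v x) : ‖v‖ ≤ ‖φ.slope‖ := by
  have h1 := h (x + v)
  simp only [add_sub_cancel_left, real_inner_self_eq_norm_sq] at h1
  have h2 : max (φ.eval (x + v)) 0 - max (φ.eval x) 0 ≤ ‖φ.slope‖ * ‖v‖ := by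
    have h3 := φ.eval_sub (x + v) x
    rw [add_sub_cancel_left] at h3
    have h4 := real_inner_le_norm φ.slope v
    have h5 : 0 ≤ ‖φ.slope‖ * ‖v‖ := by positivity
    have h6 := le_max_left (φ.eval x) 0
    have h7 := le_max_right (φ.eval x) 0
    have : max (φ.eval (x + v)) 0 ≤ ‖φ.slope‖ * ‖v‖ + max (φ.eval x) 0 :=
      max_le (by linarith) (by linarith)
    linarith
  rcases (norm_nonneg v).eq_or_lt with h0 | h0
  · rw [← h0]; exact norm_nonneg _
  · nlinarith

namespace Problem

variable {P : Problem d} {F G Lf Lg : ℝ}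

theorem Assumptions.f_slope_le (hP : P.Assumptions F G Lf Lg) (hL : 0 ≤ Lf) (t : ℕ) {i : ℕ}
    (hi : i ≤ P.m) : ‖(P.f t i).slope‖ ≤ Lf := by
  by_cases ht : t ≤ P.m ∨ P.T < t
  · simpa [hP.f_zero t ht i] using hL
  · exact slope_norm_le hL (hP.f_lip t (Finset.mem_Icc.2 (by omega))) hi

theorem Assumptions.g_slope_le (hP : P.Assumptions F G Lf Lg) (hL : 0 ≤ Lg) (t : ℕ) {i : ℕ}
    (hi : i ≤ P.m) : ‖(P.g t i).slope‖ ≤ Lg := by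
  by_cases ht : t ≤ P.m ∨ P.T < t
  · simpa [hP.g_zero t ht i] using hL
  · exact slope_norm_le hL (hP.g_lip t (Finset.mem_Icc.2 (by omega))) hi

theorem violation_mono (P : Problem d) (x : ℕ → Space d) : Monotone (P.violation x) :=
  fun _ _ h => Finset.sum_le_sum_of_subset_of_nonneg (Finset.Icc_subset_Icc le_rfl h)
    fun _ _ _ => le_max_right _ _

theorem violation_nonneg (P : Problem d) (x : ℕ → Space d) (t : ℕ) : 0 ≤ P.violation x t :=
  Finset.sum_nonneg fun _ _ => le_max_right _ _

theorem Assumptions.violation_eq_zero (hP : P.Assumptions F G Lf Lg) (x : ℕ → Space d) {t : ℕ}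
    (ht : t ≤ P.m) : P.violation x t = 0 := by
  refine Finset.sum_eq_zero fun k hk => ?_
  have hk' := Finset.mem_Icc.1 hk
  simp [constrAt, memVal, LinFun.eval, hP.g_zero k (Or.inl (by omega))]

end Problem

/-! ### Multipliers and hint errors -/

namespace Run

variable {R : Run d} {P : Problem d} {F G Lf Lg ρ : ℝ}

theorem weight_eq (R : Run d) (P : Problem d) (k : ℕ) :
    R.weight P k = R.lam * Real.exp (R.lam * P.violation R.x (k - P.m - 1)) := by
  have h : HasDerivAt (penalty R.lam)
      (Real.exp (R.lam * P.violation R.x (k - P.m - 1)) * (R.lam * 1))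
      (P.violation R.x (k - P.m - 1)) :=
    (((hasDerivAt_id' _).const_mul R.lam).exp).sub_const 1
  rw [weight, h.deriv]; ring

theorem weight_nonneg (hlam : 0 ≤ R.lam) (k : ℕ) : 0 ≤ R.weight P k := by
  rw [weight_eq]; positivity

theorem weight_mono (hlam : 0 ≤ R.lam) : Monotone (R.weight P) := by
  intro k l hkl
  rw [weight_eq, weight_eq]
  have := P.violation_mono R.x (by omega : k - P.m - 1 ≤ l - P.m - 1)
  gcongr

theorem weight_eq_lam (hP : P.Assumptions F G Lf Lg) {k : ℕ} (hk : k ≤ 2 * P.m + 1) :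
    R.weight P k = R.lam := by
  rw [weight_eq, hP.violation_eq_zero R.x (by omega)]; simp

theorem weight_le (hlam : 0 ≤ R.lam) {k : ℕ} (hk : k ≤ P.T + P.m + 1) :
    R.weight P k ≤ R.lam * Real.exp (R.lam * P.violation R.x P.T) := by
  rw [weight_eq]
  have := P.violation_mono R.x (by omega : k - P.m - 1 ≤ P.T)
  gcongr

theorem IsODAF.gradG_le (hR : R.IsODAF P Lf Lg ρ) (hP : P.Assumptions F G Lf Lg) {s i : ℕ}
    (hs : s ≤ P.T) (hi : i ≤ P.m) : ‖R.gradG s i‖ ≤ Lg :=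
  (hR.subgrad s hs i hi).norm_le.trans
    (hP.g_slope_le ((norm_nonneg _).trans (hR.predG_le 0 0 0)) _ hi)

theorem IsODAF.gradZ_le (hR : R.IsODAF P Lf Lg ρ) (hP : P.Assumptions F G Lf Lg)
    (hlam : 0 ≤ R.lam) {s : ℕ} (hs : s ≤ P.T) (hsm : s ≤ P.m + 1) :
    ‖R.gradZ P s‖ ≤ (P.m + 1) * (Lf + R.lam * Lg) := by
  have hLf : 0 ≤ Lf := (norm_nonneg _).trans (hR.predF_le 0 0 0)
  refine (norm_sum_le_of_le _ (fun i hi => ?_) (n := fun _ => Lf + R.lam * Lg)).trans ?_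
  · have hi' : i ≤ P.m := by have := Finset.mem_range.1 hi; omega
    rw [weight_eq_lam hP (by omega)]
    refine norm_add_le_of_le (hP.f_slope_le hLf _ hi') ?_
    rw [norm_smul, Real.norm_of_nonneg hlam]
    exact mul_le_mul_of_nonneg_left (hR.gradG_le hP hs hi') hlam
  · rw [Finset.sum_const, Finset.card_range, nsmul_eq_mul]
    push_cast
    exact le_rfl

/-- Summation by parts: a weighted sum over rounds `t ≤ s + i ≤ t + m` as a combination of the
sums over the tails `s + i ≥ t + j`. -/
theorem sum_weight_smul_eq (w : ℕ → ℝ) (D : ℕ → ℕ → Space d) (m t : ℕ) :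
    ∑ s ∈ Finset.Icc (t - m) t, ∑ i ∈ Finset.Icc (t - s) m, w (s + i) • D s i =
      w t • (∑ s ∈ Finset.Icc (t - m) t, ∑ i ∈ Finset.Icc (t - s) m, D s i) +
        ∑ j ∈ Finset.range m, (w (t + (j + 1)) - w (t + j)) •
          ∑ s ∈ Finset.Icc (t - m) t, ∑ i ∈ Finset.Icc (t + (j + 1) - s) m, D s i := by
  simp only [Finset.smul_sum]
  rw [Finset.sum_comm, ← Finset.sum_add_distrib]
  refine Finset.sum_congr rfl fun s hs => ?_
  have hs' := Finset.mem_Icc.1 hs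
  -- A slice of round `s + i` lies in exactly the tails with `j < s + i - t`, so its coefficients
  -- telescope from `w t` to `w (s + i)`.
  have h1 : ∀ j, ∑ i ∈ Finset.Icc (t + (j + 1) - s) m, (w (t + (j + 1)) - w (t + j)) • D s i =
      ∑ i ∈ Finset.Icc (t - s) m,
        (if j < s + i - t then w (t + (j + 1)) - w (t + j) else 0) • D s i := by
    intro j
    rw [← Finset.sum_subset (Finset.Icc_subset_Icc_left (by omega : t - s ≤ t + (j + 1) - s))]
    · refine Finset.sum_congr rfl fun i hi => ?_
      have hi' := Finset.mem_Icc.1 hi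
      rw [if_pos (by omega)]
    · intro i hi hi2
      simp only [Finset.mem_Icc] at hi hi2
      rw [if_neg (by omega), zero_smul]
  simp only [h1]
  rw [Finset.sum_comm, ← Finset.sum_add_distrib]
  refine Finset.sum_congr rfl fun i hi => ?_
  have hi' := Finset.mem_Icc.1 hi
  rw [← Finset.sum_smul, ← add_smul]
  congr 1
  have h2 : (Finset.range m).filter (fun j => j < s + i - t) = Finset.range (s + i - t) := by
    ext j; simp only [Finset.mem_filter, Finset.mem_range]; omega
  rw [← Finset.sum_filter, h2, Finset.sum_range_sub (fun j => w (t + j))]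
  rw [show t + (s + i - t) = s + i by omega]
  simp

theorem epsF_nonneg (R : Run d) (P : Problem d) (t : ℕ) : 0 ≤ R.epsF P t := sq_nonneg _

theorem tail_sq_le_epsG (R : Run d) (P : Problem d) (t : ℕ) {j : ℕ} (hj : j ≤ P.m) :
    ‖∑ s ∈ Finset.Icc (t - P.m) t, ∑ i ∈ Finset.Icc (t + j - s) P.m,
      (R.predG t s i - R.gradG s i)‖ ^ 2 ≤ R.epsG P t :=
  Finset.le_sup' (fun j => ‖∑ s ∈ Finset.Icc (t - P.m) t, ∑ i ∈ Finset.Icc (t + j - s) P.m,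
      (R.predG t s i - R.gradG s i)‖ ^ 2) (Finset.mem_range.2 (by omega))

theorem epsG_nonneg (R : Run d) (P : Problem d) (t : ℕ) : 0 ≤ R.epsG P t :=
  (sq_nonneg _).trans (tail_sq_le_epsG R P t (Nat.zero_le _))

theorem hint_sub_eq (R : Run d) (P : Problem d) (t : ℕ) :
    R.hint P t - ∑ s ∈ Finset.Icc (t - P.m) t, R.gradZ P s =
      ∑ s ∈ Finset.Icc (t - P.m) t, ∑ i ∈ Finset.Icc (t - s) P.m,
        (R.predF t s i - (P.f (s + i) i).slope) +
      ∑ s ∈ Finset.Icc (t - P.m) t, ∑ i ∈ Finset.Icc (t - s) P.m,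
        R.weight P (s + i) • (R.predG t s i - R.gradG s i) := by
  rw [hint, ← Finset.sum_sub_distrib, ← Finset.sum_add_distrib]
  refine Finset.sum_congr rfl fun s hs => ?_
  rw [gradZ, ← Finset.sum_sub_distrib, ← Finset.sum_add_distrib]
  symm
  have hsub : Finset.Icc (t - s) P.m ⊆ Finset.range (P.m + 1) := fun i hi => by
    have := Finset.mem_Icc.1 hi
    exact Finset.mem_range.2 (by omega)
  rw [← Finset.sum_subset hsub]
  · refine Finset.sum_congr rfl fun i hi => ?_
    have := Finset.mem_Icc.1 hi
    rw [if_neg (by omega), smul_sub]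
    abel
  · intro i hi hi2
    simp only [Finset.mem_Icc, Finset.mem_range] at hi hi2
    rw [if_pos (by omega), sub_self]

/-- By monotonicity all Abel coefficients are nonnegative, and they add up to the last multiplier;
this is why `epsG` is a maximum over tails. -/
theorem hintErr_le (hlam : 0 ≤ R.lam) (t : ℕ) :
    R.hintErr P t ≤ √(R.epsF P t) + R.weight P (t + P.m) * √(R.epsG P t) := by
  rw [hintErr, hint_sub_eq]
  refine norm_add_le_of_le (Real.le_sqrt_of_sq_le le_rfl) ?_
  rw [sum_weight_smul_eq]
  have htail : ∀ j ≤ P.m, ‖∑ s ∈ Finset.Icc (t - P.m) t, ∑ i ∈ Finset.Icc (t + j - s) P.m,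
      (R.predG t s i - R.gradG s i)‖ ≤ √(R.epsG P t) :=
    fun j hj => Real.le_sqrt_of_sq_le (tail_sq_le_epsG R P t hj)
  have hw : R.weight P (t + P.m) = R.weight P t +
      ∑ j ∈ Finset.range P.m, (R.weight P (t + (j + 1)) - R.weight P (t + j)) := by
    rw [Finset.sum_range_sub (fun j => R.weight P (t + j))]; simp
  rw [hw, add_mul, Finset.sum_mul]
  refine norm_add_le_of_le ?_ (norm_sum_le_of_le _ fun j hj => ?_)
  · rw [norm_smul, Real.norm_of_nonneg (weight_nonneg hlam t)]
    exact mul_le_mul_of_nonneg_left (htail 0 (Nat.zero_le _)) (weight_nonneg hlam t)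
  · have hj' := Finset.mem_range.1 hj
    have h0 : 0 ≤ R.weight P (t + (j + 1)) - R.weight P (t + j) :=
      sub_nonneg.2 (weight_mono hlam (by omega))
    rw [norm_smul, Real.norm_of_nonneg h0]
    exact mul_le_mul_of_nonneg_left (htail (j + 1) (by omega)) h0

theorem norm_double_sum_le {D : ℕ → ℕ → Space d} {m t : ℕ} {l : ℕ → ℕ} {B : ℝ} (hB : 0 ≤ B)
    (h : ∀ s ≤ t, ∀ i ≤ m, ‖D s i‖ ≤ B) :
    ‖∑ s ∈ Finset.Icc (t - m) t, ∑ i ∈ Finset.Icc (l s) m, D s i‖ ≤ (m + 1) ^ 2 * B := by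
  refine (norm_sum_le_of_le _ (n := fun _ => (m + 1) * B) fun s hs => ?_).trans ?_
  · refine (norm_sum_le_of_le _ (n := fun _ => B) fun i hi => ?_).trans ?_
    · exact h s (Finset.mem_Icc.1 hs).2 i (Finset.mem_Icc.1 hi).2
    · rw [Finset.sum_const, nsmul_eq_mul, Nat.card_Icc]
      refine mul_le_mul_of_nonneg_right ?_ hB
      exact_mod_cast (by omega : m + 1 - l s ≤ m + 1)
  · rw [Finset.sum_const, nsmul_eq_mul, Nat.card_Icc, sq, mul_assoc]
    refine mul_le_mul_of_nonneg_right ?_ (by positivity)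
    exact_mod_cast (by omega : t + 1 - (t - m) ≤ m + 1)

theorem IsODAF.sqrt_epsF_le (hR : R.IsODAF P Lf Lg ρ) (hP : P.Assumptions F G Lf Lg) (t : ℕ) :
    √(R.epsF P t) ≤ (P.m + 1) ^ 2 * (2 * Lf) := by
  have hLf : 0 ≤ Lf := (norm_nonneg _).trans (hR.predF_le 0 0 0)
  rw [epsF, Real.sqrt_sq (norm_nonneg _)]
  refine norm_double_sum_le (by positivity) fun s _ i hi => ?_
  have := norm_sub_le_of_le (hR.predF_le t s i) (hP.f_slope_le hLf (s + i) hi)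
  linarith

theorem IsODAF.sqrt_epsG_le (hR : R.IsODAF P Lf Lg ρ) (hP : P.Assumptions F G Lf Lg) {t : ℕ}
    (ht : t ≤ P.T) : √(R.epsG P t) ≤ (P.m + 1) ^ 2 * (2 * Lg) := by
  have hLg : 0 ≤ Lg := (norm_nonneg _).trans (hR.predG_le 0 0 0)
  refine Real.sqrt_le_iff.2 ⟨by positivity, Finset.sup'_le _ _ fun j _ => ?_⟩
  refine pow_le_pow_left₀ (norm_nonneg _)
    (norm_double_sum_le (by positivity) fun s hs i hi => ?_) 2
  have := norm_sub_le_of_le (hR.predG_le t s i) (hR.gradG_le hP (hs.trans ht) hi)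
  linarith

/-- Rounds before `m` are not counted in `errF` and `errG`. Their multipliers are still `λ`, so a
bound free of the violation is available. -/
theorem IsODAF.hintErr_le_of_lt (hR : R.IsODAF P Lf Lg ρ) (hP : P.Assumptions F G Lf Lg)
    (hlam : 0 ≤ R.lam) {t : ℕ} (ht : t ≤ P.T) (htm : t < P.m) :
    R.hintErr P t ≤ 2 * (P.m + 1) ^ 2 * (Lf + R.lam * Lg) := by
  have h1 := hintErr_le (P := P) hlam t
  rw [weight_eq_lam hP (by omega)] at h1
  have h2 := hR.sqrt_epsF_le hP t
  have h3 := mul_le_mul_of_nonneg_left (hR.sqrt_epsG_le hP ht) hlam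
  linarith

theorem sqrt_add_le {a b : ℝ} (ha : 0 ≤ a) (hb : 0 ≤ b) : √(a + b) ≤ √a + √b := by
  refine Real.sqrt_le_iff.2 ⟨by positivity, ?_⟩
  nlinarith [Real.sq_sqrt ha, Real.sq_sqrt hb, mul_nonneg (Real.sqrt_nonneg a) (Real.sqrt_nonneg b)]

/-- The accumulated hint errors in terms of the prediction errors and the final violation. -/
theorem IsODAF.sqrt_sum_hintErr_le (hR : R.IsODAF P Lf Lg ρ) (hP : P.Assumptions F G Lf Lg)
    (hlam : 0 ≤ R.lam) (hmT : P.m ≤ P.T) :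
    √(∑ t ∈ Finset.range (P.T + 1), R.hintErr P t ^ 2) ≤
      √2 * √(R.errF P) +
        √2 * (R.lam * Real.exp (R.lam * P.violation R.x P.T) * √(R.errG P)) +
        P.m * (2 * (P.m + 1) ^ 2 * (Lf + R.lam * Lg)) := by
  set W := R.lam * Real.exp (R.lam * P.violation R.x P.T) with hW
  have hW0 : 0 ≤ W := by positivity
  have hEF : 0 ≤ R.errF P := Finset.sum_nonneg fun t _ => epsF_nonneg R P t
  have hEG : 0 ≤ R.errG P := Finset.sum_nonneg fun t _ => epsG_nonneg R P t
  have hsplit : ∑ t ∈ Finset.range (P.T + 1), R.hintErr P t ^ 2 =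
      ∑ t ∈ Finset.Icc P.m P.T, R.hintErr P t ^ 2 +
        ∑ t ∈ Finset.range P.m, R.hintErr P t ^ 2 := by
    rw [← Finset.sum_range_add_sum_Ico _ (by omega : P.m ≤ P.T + 1), add_comm]
    rfl
  -- `(x + y) ^ 2 ≤ 2 x ^ 2 + 2 y ^ 2` is the origin of the factor `√2` in `regretConst`.
  have hmain : ∑ t ∈ Finset.Icc P.m P.T, R.hintErr P t ^ 2 ≤
      2 * R.errF P + 2 * (W ^ 2 * R.errG P) := by
    rw [errF, errG, Finset.mul_sum, Finset.mul_sum, Finset.mul_sum, ← Finset.sum_add_distrib]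
    refine Finset.sum_le_sum fun t ht => ?_
    have ht' := Finset.mem_Icc.1 ht
    have h1 : R.hintErr P t ≤ √(R.epsF P t) + W * √(R.epsG P t) := by
      refine (hintErr_le hlam t).trans ?_
      gcongr
      exact weight_le hlam (by omega)
    have h2 : R.hintErr P t ^ 2 ≤ _ := pow_le_pow_left₀ (norm_nonneg _) h1 2
    have h3 := Real.sq_sqrt (epsF_nonneg R P t)
    have h4 := Real.sq_sqrt (epsG_nonneg R P t)
    have h5 : W ^ 2 * R.epsG P t = (W * √(R.epsG P t)) ^ 2 := by rw [mul_pow W, h4]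
    rw [h5]
    nlinarith [sq_nonneg (√(R.epsF P t) - W * √(R.epsG P t))]
  have hinit : √(∑ t ∈ Finset.range P.m, R.hintErr P t ^ 2) ≤
      P.m * (2 * (P.m + 1) ^ 2 * (Lf + R.lam * Lg)) := by
    refine (Real.sqrt_le_sqrt (Finset.sum_sq_le_sq_sum_of_nonneg fun t _ => norm_nonneg _)).trans ?_
    rw [Real.sqrt_sq (Finset.sum_nonneg fun t _ => norm_nonneg _)]
    refine (Finset.sum_le_card_nsmul _ _ (2 * (P.m + 1) ^ 2 * (Lf + R.lam * Lg))
      fun t ht => ?_).trans (by simp)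
    have := Finset.mem_range.1 ht
    exact hR.hintErr_le_of_lt hP hlam (by omega) this
  rw [hsplit]
  refine (sqrt_add_le (Finset.sum_nonneg fun t _ => sq_nonneg _)
    (Finset.sum_nonneg fun t _ => sq_nonneg _)).trans (add_le_add ?_ hinit)
  refine (Real.sqrt_le_sqrt hmain).trans ((sqrt_add_le (by positivity) (by positivity)).trans ?_)
  rw [Real.sqrt_mul zero_le_two, Real.sqrt_mul zero_le_two, Real.sqrt_mul (sq_nonneg W),
    Real.sqrt_sq hW0]

/-! ### Linearized regret of the forward functions -/

theorem aTerm_nonneg (R : Run d) (P : Problem d) (t : ℕ) : 0 ≤ R.aTerm P t :=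
  mul_nonneg Metric.diam_nonneg (le_min (norm_nonneg _) (norm_nonneg _))

theorem bTerm_nonneg (R : Run d) (P : Problem d) (t : ℕ) : 0 ≤ R.bTerm P t :=
  huber_nonneg (norm_nonneg _) (norm_nonneg _)

theorem muNext_eq (R : Run d) (P : Problem d) (t : ℕ) :
    R.muNext P t = delayedBound P.m R.α (R.aTerm P) (R.bTerm P) (t - P.m) / R.α := by
  rw [muNext, delayedBound]; ring

theorem inner_sum_sub_le {X : Set (Space d)} (hb : Bornology.IsBounded X) {z x : ℕ → Space d}
    {u : Space d} (hu : u ∈ X) {S : Finset ℕ} (hx : ∀ s ∈ S, x s ∈ X) :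
    ∑ s ∈ S, ⟪z s, x s - u⟫ ≤ Metric.diam X * ∑ s ∈ S, ‖z s‖ := by
  rw [Finset.mul_sum]
  refine Finset.sum_le_sum fun s hs => (real_inner_le_norm _ _).trans ?_
  rw [mul_comm, ← dist_eq_norm]
  exact mul_le_mul_of_nonneg_right (Metric.dist_le_diam_of_mem hb (hx s hs) hu) (norm_nonneg _)

/-- The linearized regret of the forward functions, when there is a round without initial history. -/
theorem IsODAF.regret_forward_le_of_lt (hR : R.IsODAF P Lf Lg ρ) (hP : P.Assumptions F G Lf Lg)
    (hα : 0 < R.α) (hT : P.m + 2 ≤ P.T) {u : Space d} (hu : u ∈ P.X) :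
    ∑ s ∈ Finset.Icc 1 P.T, ⟪R.gradZ P s, R.x s - u⟫ ≤
      (ρ / R.α + 1) * delayedBound P.m R.α (R.aTerm P) (R.bTerm P) P.T +
        2 * Metric.diam P.X * ∑ s ∈ Finset.Icc 1 (P.m + 1), ‖R.gradZ P s‖ := by
  set U := delayedBound P.m R.α (R.aTerm P) (R.bTerm P) with hU
  set μ : ℕ → ℝ := fun t => R.muNext P (t - 1) with hμ
  have hμU : ∀ t, R.α * μ t = U (t - 1 - P.m) := fun t => by
    rw [hμ]; simp only [muNext_eq]; rw [mul_div_cancel₀ _ hα.ne']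
  have hUmono : Monotone U := delayedBound_mono hα.le (bTerm_nonneg R P)
  have hU0 : ∀ t, 0 ≤ U t := delayedBound_nonneg (aTerm_nonneg R P)
  have hμ0 : ∀ t, 0 ≤ μ t := fun t => by
    simp only [hμ, muNext_eq]; exact div_nonneg (hU0 _) hα.le
  have hμmono : Monotone μ := fun s t hst => by
    simp only [hμ, muNext_eq]
    exact div_le_div_of_nonneg_right (hUmono (by omega)) hα.le
  have hdrift : ∀ t, ∃ δ : ℝ, 0 ≤ δ ∧ δ ≤ R.aTerm P t ∧ (t ≤ P.m + 1 → δ = 0) ∧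
      (P.m + 2 ≤ t → t ≤ P.T → μ t * δ ≤ R.bTerm P t ∧ ∀ w ∈ P.X, ∃ y ∈ P.X,
        ⟪R.gradZ P t, R.x t⟫ + (⟪∑ s ∈ Finset.Icc 1 (t - 1), R.gradZ P s, y⟫ + μ t * R.r y) ≤
        ⟪∑ s ∈ Finset.Icc 1 (t - 1), R.gradZ P s + R.gradZ P t, w⟫ + μ t * R.r w + δ) := by
    intro t
    by_cases ht : P.m + 2 ≤ t ∧ t ≤ P.T
    · obtain ⟨n, rfl⟩ : ∃ n, t = n + 1 := ⟨t - 1, by omega⟩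
      -- The effective hint: with it the delayed update is an undelayed one whose error at
      -- `∇Z_{n+1}` is `hintErr`.
      set p := R.hint P (n + 1) - ∑ s ∈ Finset.Icc (n + 1 - P.m) n, R.gradZ P s with hp
      have hmin := hR.update n (by omega) ht.2
      have hsum : ∑ s ∈ Finset.Icc 1 n, R.gradZ P s = ∑ s ∈ Finset.Icc 1 (n - P.m), R.gradZ P s +
          ∑ s ∈ Finset.Icc (n + 1 - P.m) n, R.gradZ P s := by
        have e3 : Finset.Icc (n + 1 - P.m) n = Finset.Ioc (n - P.m) n := by
          ext k; simp only [Finset.mem_Icc, Finset.mem_Ioc]; omega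
        rw [e3]
        exact (Finset.sum_Ioc_consecutive _ (Nat.zero_le (n - P.m)) (Nat.sub_le n P.m)).symm
      have hobj : R.objNext P n = fun y =>
          ⟪∑ s ∈ Finset.Icc 1 n, R.gradZ P s + p, y⟫ + μ (n + 1) * R.r y := by
        funext y
        rw [objNext, hsum, hp]
        simp only [hμ, Nat.add_sub_cancel]
        congr 2
        abel
      rw [hobj] at hmin
      obtain ⟨δ, h0, ha, hb, hw⟩ := exists_drift (g := R.gradZ P (n + 1)) hR.strong hP.bounded
        (hμ0 (n + 1)) (hR.mem _ ht.2) hmin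
      have herr : ‖p - R.gradZ P (n + 1)‖ = R.hintErr P (n + 1) := by
        rw [hintErr, Finset.sum_Icc_succ_top (by omega), hp, sub_sub]
      rw [herr] at ha hb
      exact ⟨δ, h0, ha, fun h => by omega, fun _ _ => ⟨hb, by simpa using hw⟩⟩
    · exact ⟨0, le_rfl, aTerm_nonneg R P t, fun _ => rfl, fun h1 h2 => absurd ⟨h1, h2⟩ ht⟩
  choose δ hδ0 hδa hδi hδ using hdrift
  set Z₀ := ∑ s ∈ Finset.Icc 1 (P.m + 1), R.gradZ P s with hZ₀
  -- Rounds up to `m + 1` obey no update rule; the crude lower bound `κ` for the starting potential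
  -- costs `diam * ‖Z₀‖`.
  have htel := ftrl_telescope (t₀ := P.m + 1) (z := R.gradZ P) (x := R.x) (μ := μ) (δ := δ)
    (κ := ⟪Z₀, u⟫ - Metric.diam P.X * ‖Z₀‖) hR.r_nonneg hT hμmono
    (fun y hy => by
      have h1 : ⟪Z₀, u - y⟫ ≤ Metric.diam P.X * ‖Z₀‖ := by
        refine (real_inner_le_norm _ _).trans ?_
        rw [mul_comm, ← dist_eq_norm]
        exact mul_le_mul_of_nonneg_right (Metric.dist_le_diam_of_mem hP.bounded hu hy)
          (norm_nonneg _)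
      rw [inner_sub_right] at h1
      have h2 := mul_nonneg (hμ0 (P.m + 1 + 1)) (hR.r_nonneg y hy)
      linarith)
    (fun t h1 h2 => (hδ t h1 h2).2) hu
  have hsumδ : ∑ t ∈ Finset.Icc (P.m + 1 + 1) P.T, δ t ≤ U P.T := by
    refine (Finset.sum_le_sum_of_subset_of_nonneg (Finset.Icc_subset_Icc_left (by omega))
      fun t _ _ => hδ0 t).trans (sum_drift_le_delayedBound (T := P.T) hα.le (aTerm_nonneg R P)
        (bTerm_nonneg R P) hδ0 hδa hδi (fun t h1 h2 => ?_) P.T le_rfl)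
    have := mul_le_mul_of_nonneg_left (hδ t h1 h2).1 hα.le
    rw [← mul_assoc, hμU] at this
    rw [mul_comm]
    exact this
  have hreg : μ P.T * R.r u ≤ ρ / R.α * U P.T := by
    have h1 : μ P.T ≤ U P.T / R.α := by
      simp only [hμ, muNext_eq]
      exact div_le_div_of_nonneg_right (hUmono (by omega)) hα.le
    calc μ P.T * R.r u ≤ U P.T / R.α * ρ :=
          mul_le_mul h1 (hR.r_le u hu) (hR.r_nonneg u hu) (div_nonneg (hU0 _) hα.le)
      _ = ρ / R.α * U P.T := by ring
  have hinit := inner_sum_sub_le (z := R.gradZ P) (x := R.x) (S := Finset.Icc 1 (P.m + 1))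
    hP.bounded hu fun s hs => hR.mem s (by have := Finset.mem_Icc.1 hs; omega)
  have hZ : Metric.diam P.X * ‖Z₀‖ ≤
      Metric.diam P.X * ∑ s ∈ Finset.Icc 1 (P.m + 1), ‖R.gradZ P s‖ :=
    mul_le_mul_of_nonneg_left (norm_sum_le _ _) Metric.diam_nonneg
  have hsplit : ∑ s ∈ Finset.Icc 1 P.T, ⟪R.gradZ P s, R.x s⟫ =
      ∑ s ∈ Finset.Icc 1 (P.m + 1), ⟪R.gradZ P s, R.x s⟫ +
        ∑ s ∈ Finset.Icc (P.m + 1 + 1) P.T, ⟪R.gradZ P s, R.x s⟫ := by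
    have e3 : Finset.Icc (P.m + 1 + 1) P.T = Finset.Ioc (P.m + 1) P.T := by
      ext k; simp only [Finset.mem_Icc, Finset.mem_Ioc]; omega
    rw [e3]
    exact (Finset.sum_Ioc_consecutive (fun s => ⟪R.gradZ P s, R.x s⟫) (Nat.zero_le (P.m + 1))
      (by omega : P.m + 1 ≤ P.T)).symm
  simp only [inner_sub_right, Finset.sum_sub_distrib, ← sum_inner] at hinit ⊢
  rw [hsplit]
  linarith

/-- The linearized regret of the forward functions. -/
theorem IsODAF.regret_forward_le (hR : R.IsODAF P Lf Lg ρ) (hP : P.Assumptions F G Lf Lg)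
    (hα : 0 < R.α) (hlam : 0 ≤ R.lam) {u : Space d} (hu : u ∈ P.X) :
    ∑ s ∈ Finset.Icc 1 P.T, ⟪R.gradZ P s, R.x s - u⟫ ≤
      (ρ / R.α + 1) * ((2 * P.m * Metric.diam P.X + √(Metric.diam P.X ^ 2 + R.α)) *
        √(∑ t ∈ Finset.range (P.T + 1), R.hintErr P t ^ 2)) +
        2 * Metric.diam P.X * ((P.m + 1) ^ 2 * (Lf + R.lam * Lg)) := by
  have hΔ : 0 ≤ Metric.diam P.X := Metric.diam_nonneg
  have hρ : 0 ≤ ρ := (hR.r_nonneg u hu).trans (hR.r_le u hu)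
  have hLf : 0 ≤ Lf := (norm_nonneg _).trans (hR.predF_le 0 0 0)
  have hLg : 0 ≤ Lg := (norm_nonneg _).trans (hR.predG_le 0 0 0)
  have hbound := delayedBound_le (m := P.m) (T := P.T) hα.le hΔ (aTerm_nonneg R P)
    (b := R.bTerm P) (e := R.hintErr P)
    (fun t => mul_le_mul_of_nonneg_left (min_le_left _ _) hΔ) (fun t => huber_le _ _)
  have hgrad : ∀ n ≤ P.T, n ≤ P.m + 1 →
      ∑ s ∈ Finset.Icc 1 n, ‖R.gradZ P s‖ ≤ (P.m + 1) ^ 2 * (Lf + R.lam * Lg) := by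
    intro n hn hnm
    refine (Finset.sum_le_card_nsmul _ _ ((P.m + 1) * (Lf + R.lam * Lg)) fun s hs => ?_).trans ?_
    · have := Finset.mem_Icc.1 hs
      exact hR.gradZ_le hP hlam (by omega) (by omega)
    · rw [nsmul_eq_mul, Nat.card_Icc, sq, mul_assoc]
      refine mul_le_mul_of_nonneg_right ?_ (by positivity)
      exact_mod_cast (by omega : n + 1 - 1 ≤ P.m + 1)
  by_cases hT : P.m + 2 ≤ P.T
  · refine (hR.regret_forward_le_of_lt hP hα hT hu).trans (add_le_add
      (mul_le_mul_of_nonneg_left hbound (by positivity))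
      (mul_le_mul_of_nonneg_left (hgrad _ (by omega) le_rfl) (by positivity)))
  -- Here every round belongs to the initial history.
  · refine (inner_sum_sub_le hP.bounded hu fun s hs => hR.mem s (Finset.mem_Icc.1 hs).2).trans ?_
    have h1 := mul_le_mul_of_nonneg_left (hgrad P.T le_rfl (by omega)) hΔ
    have h2 : 0 ≤ Metric.diam P.X * ((P.m + 1) ^ 2 * (Lf + R.lam * Lg)) := by positivity
    have h3 : 0 ≤ (ρ / R.α + 1) * ((2 * P.m * Metric.diam P.X + √(Metric.diam P.X ^ 2 + R.α)) *
        √(∑ t ∈ Finset.range (P.T + 1), R.hintErr P t ^ 2)) := by positivity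
    linarith

end Run

/-! ### From forward functions to regret and violation -/

/-- Exchange of the rounds `t` for the rounds `s = t - i` of the decisions. -/
theorem sum_memory_reindex {m T : ℕ} (H : ℕ → ℕ → ℕ → ℝ)
    (hH : ∀ t, t ≤ m ∨ T < t → ∀ i s, H t i s = 0) :
    ∑ t ∈ Finset.Icc m T, ∑ i ∈ Finset.range (m + 1), H t i (t - i) =
      ∑ s ∈ Finset.Icc 1 T, ∑ i ∈ Finset.range (m + 1), H (s + i) i s := by
  rw [Finset.sum_comm, Finset.sum_comm (s := Finset.Icc 1 T)]
  refine Finset.sum_congr rfl fun i hi => ?_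
  have hi' := Finset.mem_range.1 hi
  have h1 : ∑ s ∈ Finset.Icc 1 T, H (s + i) i s =
      ∑ s ∈ Finset.range (T + 1), H (i + s) i (i + s - i) := by
    refine (Finset.sum_congr rfl fun s _ => by
      rw [add_comm s i, Nat.add_sub_cancel_left]).trans (Finset.sum_subset (fun s hs => ?_) ?_)
    · have := Finset.mem_Icc.1 hs
      exact Finset.mem_range.2 (by omega)
    -- Only `s = 0` is added; it acts in rounds `i ≤ m`, where `H` vanishes.
    · intro s hs hs2
      simp only [Finset.mem_range, Finset.mem_Icc] at hs hs2
      exact hH _ (Or.inl (by omega)) _ _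
  have h2 := Finset.sum_Ico_eq_sum_range (fun t => H t i (t - i)) i (i + (T + 1))
  rw [Nat.add_sub_cancel_left] at h2
  rw [h1, ← h2]
  refine Finset.sum_subset (fun t ht => ?_) fun t _ ht2 => ?_
  · have := Finset.mem_Icc.1 ht
    exact Finset.mem_Ico.2 (by omega)
  · simp only [Finset.mem_Icc] at ht2
    exact hH _ (by omega) _ _

namespace Problem

variable {P : Problem d} {F G Lf Lg : ℝ}

theorem violation_succ (P : Problem d) (x : ℕ → Space d) {t : ℕ} (ht : P.m ≤ t + 1) :
    P.violation x (t + 1) = P.violation x t + max (P.constrAt x (t + 1)) 0 :=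
  Finset.sum_Icc_succ_top ht _

theorem Assumptions.violation_add_le (hP : P.Assumptions F G Lf Lg) (hG : 0 ≤ G)
    {x : ℕ → Space d} (hx : ∀ t ≤ P.T, x t ∈ P.X) (s n : ℕ) (hs : s + n ≤ P.T) :
    P.violation x (s + n) ≤ P.violation x s + n * G := by
  induction n with
  | zero => simp
  | succ n ih =>
    have ih := ih (by omega)
    push_cast
    by_cases h : P.m ≤ s + n + 1
    · rw [← add_assoc, P.violation_succ x h]
      have hc := hP.g_bdd (s + n + 1) (Finset.mem_Icc.2 (by omega))
        (fun i => x (s + n + 1 - i)) (fun i _ => hx _ (by omega))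
      have : max (P.constrAt x (s + n + 1)) 0 ≤ G := max_le ((le_abs_self _).trans hc) hG
      linarith
    · rw [hP.violation_eq_zero x (by omega)]
      have := P.violation_nonneg x s
      positivity

theorem Assumptions.neg_le_sum_loss_sub (hP : P.Assumptions F G Lf Lg) {x : ℕ → Space d}
    (hx : ∀ t ≤ P.T, x t ∈ P.X) {u : Space d} (hu : u ∈ P.X) (hmT : P.m ≤ P.T) :
    -(2 * F * (P.T + 1)) ≤
      ∑ t ∈ Finset.Icc P.m P.T, (P.lossAt x t - P.lossAt (fun _ => u) t) := by
  have hb : ∀ t ∈ Finset.Icc P.m P.T, -(2 * F) ≤ P.lossAt x t - P.lossAt (fun _ => u) t := by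
    intro t ht
    have ht' := Finset.mem_Icc.1 ht
    have h1 := abs_le.1 (hP.f_bdd t ht (fun i => x (t - i)) (fun i _ => hx _ (by omega)))
    have h2 := abs_le.1 (hP.f_bdd t ht (fun _ => u) (fun _ _ => hu))
    simp only [lossAt]
    linarith
  have hF : 0 ≤ F := (abs_nonneg _).trans
    (hP.f_bdd P.m (Finset.mem_Icc.2 ⟨le_rfl, hmT⟩) (fun _ => u) (fun _ _ => hu))
  have := Finset.card_nsmul_le_sum _ _ _ hb
  refine le_trans ?_ this
  rw [nsmul_eq_mul, Nat.card_Icc]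
  have hc : ((P.T + 1 - P.m : ℕ) : ℝ) ≤ P.T + 1 := by exact_mod_cast Nat.sub_le _ _
  nlinarith

end Problem

/-- Isolates the dependence on `m`, so that `m ≤ T` can later turn it into a power of `T`. -/
theorem regretConst_le {α ρ Δ D : ℝ} (hα : 0 < α) (hρ : 0 ≤ ρ) (hΔ : 0 ≤ Δ) (hD : Δ ≤ D) (m : ℕ) :
    regretConst m Δ α ρ ≤ √2 * ((ρ / α + 1) * (2 * D + √(D ^ 2 + α))) * (m + 1) := by
  have hm : (0 : ℝ) ≤ m := Nat.cast_nonneg m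
  have h1 : 2 * (m : ℝ) * Δ + √(Δ ^ 2 + α) ≤ (2 * D + √(D ^ 2 + α)) * (m + 1) := by
    have h2 : √(Δ ^ 2 + α) ≤ √(D ^ 2 + α) := by gcongr
    nlinarith [mul_le_mul_of_nonneg_left hD hm, mul_nonneg hm (Real.sqrt_nonneg (D ^ 2 + α))]
  calc regretConst m Δ α ρ ≤ √2 * (ρ / α + 1) * ((2 * D + √(D ^ 2 + α)) * (m + 1)) :=
        mul_le_mul_of_nonneg_left h1 (by positivity)
    _ = _ := by ring

namespace Run

variable {R : Run d} {P : Problem d} {F G Lf Lg ρ : ℝ}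

/-- Regret and penalized violation are controlled by the linearized regret of the forward
functions. -/
theorem IsODAF.regret_add_penalty_le (hR : R.IsODAF P Lf Lg ρ) (hP : P.Assumptions F G Lf Lg)
    (hlam : 0 ≤ R.lam) {u : Space d} (hu : u ∈ P.benchmark) :
    ∑ t ∈ Finset.Icc P.m P.T, (P.lossAt R.x t - P.lossAt (fun _ => u) t) +
        ∑ t ∈ Finset.Icc P.m P.T, R.weight P t * max (P.constrAt R.x t) 0 ≤
      ∑ s ∈ Finset.Icc 1 P.T, ⟪R.gradZ P s, R.x s - u⟫ := by
  set H : ℕ → ℕ → ℕ → ℝ := fun t i s => (P.f t i).eval (R.x s) - (P.f t i).eval u +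
    R.weight P t * max ((P.g t i).eval (R.x s)) 0 with hH
  have hzero : ∀ t, t ≤ P.m ∨ P.T < t → ∀ i s, H t i s = 0 := by
    intro t ht i s
    simp [hH, hP.f_zero t ht i, hP.g_zero t ht i, LinFun.eval]
  calc _ ≤ ∑ t ∈ Finset.Icc P.m P.T, ∑ i ∈ Finset.range (P.m + 1), H t i (t - i) := by
        rw [← Finset.sum_add_distrib]
        refine Finset.sum_le_sum fun t _ => ?_
        simp only [hH]
        rw [Finset.sum_add_distrib, Finset.sum_sub_distrib, ← Finset.mul_sum]
        refine add_le_add le_rfl (mul_le_mul_of_nonneg_left ?_ (weight_nonneg hlam t))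
        rw [Problem.constrAt, memVal]
        exact max_le (Finset.sum_le_sum fun i _ => le_max_left _ _)
          (Finset.sum_nonneg fun i _ => le_max_right _ _)
    _ = ∑ s ∈ Finset.Icc 1 P.T, ∑ i ∈ Finset.range (P.m + 1), H (s + i) i s :=
        sum_memory_reindex H hzero
    _ ≤ _ := by
        refine Finset.sum_le_sum fun s hs => ?_
        rw [gradZ, sum_inner]
        refine Finset.sum_le_sum fun i hi => ?_
        have hi' : i ≤ P.m := by have := Finset.mem_range.1 hi; omega
        have hsub := hR.subgrad s (Finset.mem_Icc.1 hs).2 i hi' u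
        have hu0 : max ((P.g (s + i) i).eval u) 0 = 0 := by
          by_cases ht : s + i ≤ P.m ∨ P.T < s + i
          · simp [hP.g_zero _ ht i, LinFun.eval]
          · exact max_eq_right (hu.2 _ (Finset.mem_Icc.2 (by omega)) i hi')
        simp only [hu0] at hsub
        have h1 : max ((P.g (s + i) i).eval (R.x s)) 0 ≤ ⟪R.gradG s i, R.x s - u⟫ := by
          rw [← neg_sub u, inner_neg_right]; linarith
        have h2 := mul_le_mul_of_nonneg_left h1 (weight_nonneg (P := P) hlam (s + i))
        rw [inner_add_left, real_inner_smul_left, ← LinFun.eval_sub]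
        simp only [hH]
        linarith

/-- The penalty of the violation is controlled by the delayed multipliers. -/
theorem IsODAF.exp_violation_le (hR : R.IsODAF P Lf Lg ρ) (hP : P.Assumptions F G Lf Lg)
    (hG : 0 ≤ G) (hlam : 0 ≤ R.lam) (hlamG : R.lam * (G * (P.m + 1)) ≤ 1 / 2) (hmT : P.m ≤ P.T) :
    Real.exp (R.lam * P.violation R.x P.T) - 1 ≤ Real.exp (1 / 2) *
      ∑ k ∈ Finset.Icc P.m P.T, R.weight P k * max (P.constrAt R.x k) 0 := by
  suffices h : ∀ t, P.m ≤ t → t ≤ P.T → Real.exp (R.lam * P.violation R.x t) - 1 ≤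
      Real.exp (1 / 2) * ∑ k ∈ Finset.Icc P.m t, R.weight P k * max (P.constrAt R.x k) 0 from
    h _ hmT le_rfl
  intro t ht
  induction t, ht using Nat.le_induction with
  | base =>
    intro _
    rw [hP.violation_eq_zero R.x le_rfl, mul_zero, Real.exp_zero, sub_self]
    exact mul_nonneg (Real.exp_nonneg _)
      (Finset.sum_nonneg fun k _ => mul_nonneg (weight_nonneg hlam k) (le_max_right _ _))
  | succ t ht ih =>
    intro hT
    have ih := ih (by omega)
    rw [Finset.sum_Icc_succ_top (by omega), mul_add]
    set c := max (P.constrAt R.x (t + 1)) 0 with hc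
    have hc0 : 0 ≤ c := le_max_right _ _
    have hV : P.violation R.x (t + 1) = P.violation R.x t + c := P.violation_succ R.x (by omega)
    -- Convexity: the increment is at most `c` times the derivative at the right end.
    have hstep : Real.exp (R.lam * P.violation R.x (t + 1)) -
        Real.exp (R.lam * P.violation R.x t) ≤
          R.lam * c * Real.exp (R.lam * P.violation R.x (t + 1)) := by
      have h1 : Real.exp (R.lam * P.violation R.x t) =
          Real.exp (R.lam * P.violation R.x (t + 1)) * Real.exp (-(R.lam * c)) := by
        rw [← Real.exp_add, hV]; congr 1; ring
      have h2 := Real.add_one_le_exp (-(R.lam * c))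
      rw [h1]
      nlinarith [mul_le_mul_of_nonneg_left h2
        (Real.exp_nonneg (R.lam * P.violation R.x (t + 1)))]
    -- Going back `m + 1` rounds to the multiplier in use costs a factor `exp (1/2)`.
    have hexp : Real.exp (R.lam * P.violation R.x (t + 1)) ≤
        Real.exp (1 / 2) * Real.exp (R.lam * P.violation R.x (t + 1 - P.m - 1)) := by
      rw [← Real.exp_add, Real.exp_le_exp]
      have h1 := hP.violation_add_le hG hR.mem (t + 1 - P.m - 1) (P.m + 1) (by omega)
      rw [show t + 1 - P.m - 1 + (P.m + 1) = t + 1 by omega] at h1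
      push_cast at h1
      nlinarith [mul_le_mul_of_nonneg_left h1 hlam]
    have hfin := mul_le_mul_of_nonneg_left hexp (mul_nonneg hlam hc0)
    rw [weight_eq]
    linarith

/-- Absorption needs only `exp (1/2) < 2`; the value `5/3` leaves the margin `3/5 - 1/2 = 1/10`. -/
theorem exp_half_le : Real.exp (1 / 2) ≤ 5 / 3 := by
  have h1 : Real.exp (1 / 2) ^ 2 = Real.exp 1 := by
    rw [← Real.exp_nat_mul]; norm_num
  have h2 := Real.exp_one_lt_d9
  have h3 := Real.exp_pos (1 / 2)
  nlinarith

/-- Regret and exponential of the violation together, against any benchmark decision. -/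
theorem IsODAF.regret_add_exp_violation_le (hR : R.IsODAF P Lf Lg ρ)
    (hP : P.Assumptions F G Lf Lg) (hα : 0 < R.α) (hG : 0 < G) (hmT : P.m ≤ P.T) {D C : ℝ}
    (hD : Metric.diam P.X ≤ D) (hC : regretConst P.m (Metric.diam P.X) R.α ρ ≤ C)
    (hlam : R.lam = 1 / (2 * (C * √(R.errG P) + G * (P.m + 1))))
    {u : Space d} (hu : u ∈ P.benchmark) :
    ∑ t ∈ Finset.Icc P.m P.T, (P.lossAt R.x t - P.lossAt (fun _ => u) t) +
        Real.exp (R.lam * P.violation R.x P.T) / 10 ≤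
      regretConst P.m (Metric.diam P.X) R.α ρ * √(R.errF P) +
        (1 + 2 * (D + (ρ / R.α + 1) * (2 * D + √(D ^ 2 + R.α))) * (Lf + Lg / (2 * G)) *
          (P.m + 1) ^ 4) := by
  have hρ : 0 ≤ ρ := (hR.r_nonneg u hu.1).trans (hR.r_le u hu.1)
  have hLf : 0 ≤ Lf := (norm_nonneg _).trans (hR.predF_le 0 0 0)
  have hLg : 0 ≤ Lg := (norm_nonneg _).trans (hR.predG_le 0 0 0)
  set Δ := Metric.diam P.X with hΔdef
  have hΔ : 0 ≤ Δ := Metric.diam_nonneg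
  have hD0 : 0 ≤ D := hΔ.trans hD
  set Q := (ρ / R.α + 1) * (2 * P.m * Δ + √(Δ ^ 2 + R.α)) with hQ
  have hQ0 : 0 ≤ Q := by positivity
  have hC0 : regretConst P.m Δ R.α ρ = √2 * Q := by rw [regretConst, hQ]; ring
  rw [hC0] at hC ⊢
  have hm1 : (1 : ℝ) ≤ P.m + 1 := by simp
  have hsG : 0 ≤ √(R.errG P) := Real.sqrt_nonneg _
  have hC1 : 0 ≤ C := (by positivity : 0 ≤ √2 * Q).trans hC
  set Y := C * √(R.errG P) + G * (P.m + 1) with hY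
  have hGm : 0 < G * (P.m + 1) := by positivity
  have hCs : 0 ≤ C * √(R.errG P) := by positivity
  have hY0 : 0 < Y := by positivity
  have hlam0 : 0 ≤ R.lam := by rw [hlam]; positivity
  have hlamY : R.lam * Y = 1 / 2 := by rw [hlam]; field_simp
  have hlamG : R.lam * (G * (P.m + 1)) ≤ 1 / 2 := by
    rw [← hlamY]; exact mul_le_mul_of_nonneg_left (by linarith) hlam0
  have hlamC : R.lam * (√2 * Q * √(R.errG P)) ≤ 1 / 2 := by
    rw [← hlamY]
    refine mul_le_mul_of_nonneg_left ?_ hlam0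
    have := mul_le_mul_of_nonneg_right hC hsG
    linarith
  have hlamle : R.lam ≤ 1 / (2 * G) := by
    rw [hlam]
    refine one_div_le_one_div_of_le (by positivity) ?_
    nlinarith
  have hB : Lf + R.lam * Lg ≤ Lf + Lg / (2 * G) := by
    have := mul_le_mul_of_nonneg_right hlamle hLg
    have h2 : 1 / (2 * G) * Lg = Lg / (2 * G) := by ring
    linarith
  set B := Lf + Lg / (2 * G) with hBdef
  have hB0 : 0 ≤ B := by positivity
  have hQD : Q ≤ (ρ / R.α + 1) * (2 * D + √(D ^ 2 + R.α)) * (P.m + 1) := by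
    have h := regretConst_le hα hρ hΔ hD P.m
    rw [hC0, mul_assoc] at h
    exact le_of_mul_le_mul_left h (by positivity)
  set q := (ρ / R.α + 1) * (2 * D + √(D ^ 2 + R.α)) with hq
  have hq0 : 0 ≤ q := by positivity
  set X := Real.exp (R.lam * P.violation R.x P.T) with hX
  have hX0 : 0 < X := Real.exp_pos _
  have h1 := hR.regret_add_penalty_le hP hlam0 hu
  have h2 := hR.exp_violation_le hP hG.le hlam0 hlamG hmT
  have h3 := hR.regret_forward_le hP hα hlam0 hu.1
  have h4 := mul_le_mul_of_nonneg_left (hR.sqrt_sum_hintErr_le hP hlam0 hmT) hQ0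
  rw [← hΔdef, ← mul_assoc, ← hQ] at h3
  set S := ∑ k ∈ Finset.Icc P.m P.T, R.weight P k * max (P.constrAt R.x k) 0 with hS
  have hS0 : 0 ≤ S :=
    Finset.sum_nonneg fun k _ => mul_nonneg (weight_nonneg hlam0 k) (le_max_right _ _)
  have h5 : X - 1 ≤ 5 / 3 * S := h2.trans (mul_le_mul_of_nonneg_right exp_half_le hS0)
  have h6 : Q * (√2 * (R.lam * X * √(R.errG P))) ≤ 1 / 2 * X := by
    have := mul_le_mul_of_nonneg_right hlamC hX0.le
    linarith
  have h7 : Q * (P.m * (2 * (P.m + 1) ^ 2 * (Lf + R.lam * Lg))) ≤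
      2 * q * B * (P.m + 1) ^ 4 := by
    calc Q * (P.m * (2 * (P.m + 1) ^ 2 * (Lf + R.lam * Lg)))
        ≤ (q * (P.m + 1)) * ((P.m + 1) * (2 * (P.m + 1) ^ 2 * B)) := by
          gcongr
          linarith
      _ = 2 * q * B * (P.m + 1) ^ 4 := by ring
  have h8 : 2 * Δ * ((P.m + 1) ^ 2 * (Lf + R.lam * Lg)) ≤ 2 * D * B * (P.m + 1) ^ 4 := by
    calc 2 * Δ * ((P.m + 1) ^ 2 * (Lf + R.lam * Lg))
        ≤ 2 * D * ((P.m + 1) ^ 4 * B) := by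
          gcongr
          norm_num
      _ = 2 * D * B * (P.m + 1) ^ 4 := by ring
  -- With `X ≤ 1 + 5/3 * S` from `h5` and the cost `X / 2` from `h6`, `X / 10` survives; the
  -- leftover `3/5` goes into the constant `1`.
  linarith

/-- A crude polynomial bound suffices, as it enters the violation only through a logarithm. -/
theorem IsODAF.sqrt_errF_le (hR : R.IsODAF P Lf Lg ρ) (hP : P.Assumptions F G Lf Lg)
    (hmT : P.m ≤ P.T) : √(R.errF P) ≤ (P.T + 1) ^ 3 * (2 * Lf) := by
  have hLf : 0 ≤ Lf := (norm_nonneg _).trans (hR.predF_le 0 0 0)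
  have hmT' : (P.m : ℝ) ≤ P.T := by exact_mod_cast hmT
  have h1 : R.errF P ≤ (P.T + 1) * ((P.T + 1) ^ 2 * (2 * Lf)) ^ 2 := by
    refine (Finset.sum_le_card_nsmul _ _ ((((P.T : ℝ) + 1) ^ 2 * (2 * Lf)) ^ 2)
      fun t _ => ?_).trans ?_
    · have h3 : √(R.epsF P t) ≤ (P.T + 1) ^ 2 * (2 * Lf) :=
        (hR.sqrt_epsF_le hP t).trans (by gcongr)
      exact (Real.sqrt_le_left (by positivity)).1 h3
    · rw [nsmul_eq_mul, Nat.card_Icc]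
      refine mul_le_mul_of_nonneg_right ?_ (by positivity)
      exact_mod_cast Nat.sub_le _ _
  refine Real.sqrt_le_iff.2 ⟨by positivity, h1.trans ?_⟩
  have h3 : (P.T : ℝ) + 1 ≤ (P.T + 1) ^ 2 := le_self_pow₀ (by simp) (by norm_num)
  calc ((P.T : ℝ) + 1) * ((P.T + 1) ^ 2 * (2 * Lf)) ^ 2
      ≤ (P.T + 1) ^ 2 * ((P.T + 1) ^ 2 * (2 * Lf)) ^ 2 :=
        mul_le_mul_of_nonneg_right h3 (by positivity)
    _ = ((P.T + 1) ^ 3 * (2 * Lf)) ^ 2 := by ring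

end Run

/-! ### Solving for the violation -/

theorem le_log_of_exp_le {v N T : ℝ} (hN : 1 ≤ N) (hT : 2 ≤ T)
    (h : Real.exp v ≤ N * (T + 1) ^ 4) : v ≤ (Real.log N / Real.log 2 + 8) * Real.log T := by
  have hlog2 : 0 < Real.log 2 := Real.log_pos one_lt_two
  have h1 : Real.exp v ≤ N * T ^ 8 := by
    refine h.trans (mul_le_mul_of_nonneg_left ?_ (by linarith))
    -- For `T ≥ 2` one has `T + 1 ≤ T ^ 2`.
    calc (T + 1) ^ 4 ≤ (T ^ 2) ^ 4 := pow_le_pow_left₀ (by linarith) (by nlinarith) 4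
      _ = T ^ 8 := by ring
  have h2 := Real.log_le_log (Real.exp_pos v) h1
  rw [Real.log_exp, Real.log_mul (by positivity) (by positivity), Real.log_pow] at h2
  have h3 : Real.log N ≤ Real.log N / Real.log 2 * Real.log T := by
    rw [div_mul_eq_mul_div, le_div_iff₀ hlog2]
    exact mul_le_mul_of_nonneg_left (Real.log_le_log two_pos hT) (Real.log_nonneg hN)
  push_cast at h2
  linarith

end CocoMemory

theorem mainTheorem3 (D α ρ F G Lf Lg : ℝ) (hα : 0 < α) (hG : 0 < G) :
    ∃ (K : ℝ) (A : ℕ → ℝ), ∀ (d : ℕ) (P : CocoMemory.Problem d) (R : CocoMemory.Run d) (C : ℝ),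
      P.Assumptions F G Lf Lg → Metric.diam P.X ≤ D → P.m ≤ P.T → 2 ≤ P.T →
      P.benchmark.Nonempty →
      R.α = α → R.IsODAF P Lf Lg ρ →
      CocoMemory.regretConst P.m (Metric.diam P.X) α ρ ≤ C →
      R.lam = 1 / (2 * (C * √(R.errG P) + G * (P.m + 1))) →
      P.regret R.x ≤
          CocoMemory.regretConst P.m (Metric.diam P.X) α ρ * √(R.errF P) + A P.m ∧
        P.violation R.x P.T ≤ K * (C * √(R.errG P) + (P.m + 1)) * Real.log P.T := by
  set q := (ρ / α + 1) * (2 * D + √(D ^ 2 + α)) with hq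
  set c := 2 * (D + q) * (Lf + Lg / (2 * G)) with hc
  -- Coefficients of `(T + 1) ^ 4` in the bound for `exp (λ V_T)`; the `10` undoes the `1/10`.
  -- Powers of `m + 1` are absorbed by `m ≤ T`, which keeps `K` free of `m`.
  set N := 10 * (2 * F + √2 * q * (2 * Lf) + 1 + c) with hN
  refine ⟨2 * max 1 G * (Real.log N / Real.log 2 + 8), fun m => 1 + c * (m + 1) ^ 4, ?_⟩
  intro d P R C hP hD hmT hT hne hRα hR hC hlam
  subst hRα
  have hcore := fun u hu =>
    hR.regret_add_exp_violation_le hP hα hG hmT hD hC hlam (u := u) hu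
  simp only [← hq, ← hc] at hcore
  set X := Real.exp (R.lam * P.violation R.x P.T) with hX
  have hX0 : 0 < X := Real.exp_pos _
  refine ⟨?_, ?_⟩
  · have hle : ∑ t ∈ Finset.Icc P.m P.T, P.lossAt R.x t -
        (CocoMemory.regretConst P.m (Metric.diam P.X) R.α ρ * √(R.errF P) +
          (1 + c * (P.m + 1) ^ 4)) ≤
        sInf ((fun u => ∑ t ∈ Finset.Icc P.m P.T, P.lossAt (fun _ => u) t) '' P.benchmark) := by
      refine le_csInf (hne.image _) ?_
      rintro _ ⟨u, hu, rfl⟩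
      have := hcore u hu
      rw [Finset.sum_sub_distrib] at this
      linarith
    rw [CocoMemory.Problem.regret]
    linarith
  obtain ⟨u, hu⟩ := hne
  have hcore := hcore u hu
  have hneg := hP.neg_le_sum_loss_sub hR.mem hu.1 hmT
  have hρ : 0 ≤ ρ := (hR.r_nonneg u hu.1).trans (hR.r_le u hu.1)
  have hLf : 0 ≤ Lf := (norm_nonneg _).trans (hR.predF_le 0 0 0)
  have hLg : 0 ≤ Lg := (norm_nonneg _).trans (hR.predG_le 0 0 0)
  have hF : 0 ≤ F := (abs_nonneg _).trans
    (hP.f_bdd P.m (Finset.mem_Icc.2 ⟨le_rfl, hmT⟩) (fun _ => u) (fun _ _ => hu.1))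
  have hΔ : 0 ≤ Metric.diam P.X := Metric.diam_nonneg
  have hD0 : 0 ≤ D := hΔ.trans hD
  have hq0 : 0 ≤ q := by positivity
  have hc0 : 0 ≤ c := by positivity
  have hN1 : 1 ≤ N := by
    have : 0 ≤ √2 * q * (2 * Lf) := by positivity
    rw [hN]; linarith
  have hT2 : (2 : ℝ) ≤ P.T := by exact_mod_cast hT
  have hmT' : (P.m : ℝ) + 1 ≤ P.T + 1 := by
    have : (P.m : ℝ) ≤ P.T := by exact_mod_cast hmT
    linarith
  have hconst : CocoMemory.regretConst P.m (Metric.diam P.X) R.α ρ ≤ √2 * q * (P.T + 1) :=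
    (CocoMemory.regretConst_le hα hρ hΔ hD P.m).trans
      (mul_le_mul_of_nonneg_left hmT' (by positivity))
  have herr := hR.sqrt_errF_le hP hmT
  have hXN : X ≤ N * (P.T + 1) ^ 4 := by
    have hpow : (P.T : ℝ) + 1 ≤ (P.T + 1) ^ 4 := le_self_pow₀ (by linarith) (by norm_num)
    have h1 : CocoMemory.regretConst P.m (Metric.diam P.X) R.α ρ * √(R.errF P) ≤
        √2 * q * (2 * Lf) * (P.T + 1) ^ 4 := by
      calc _ ≤ √2 * q * (P.T + 1) * ((P.T + 1) ^ 3 * (2 * Lf)) :=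
            mul_le_mul hconst herr (Real.sqrt_nonneg _) (by positivity)
        _ = _ := by ring
    have h2 : c * ((P.m : ℝ) + 1) ^ 4 ≤ c * (P.T + 1) ^ 4 := by gcongr
    have h3 : 2 * F * ((P.T : ℝ) + 1) ≤ 2 * F * (P.T + 1) ^ 4 := by gcongr
    rw [hN]
    linarith
  have hlamV := CocoMemory.le_log_of_exp_le hN1 hT2 hXN
  have hlogN : 0 ≤ Real.log N := Real.log_nonneg hN1
  have hlogT : 0 ≤ Real.log P.T := Real.log_nonneg (by linarith)
  have hlog2 : 0 < Real.log 2 := Real.log_pos one_lt_two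
  have hC0 : 0 ≤ C := le_trans (by rw [CocoMemory.regretConst]; positivity) hC
  have hCs : 0 ≤ C * √(R.errG P) := by positivity
  set Y := C * √(R.errG P) + G * (P.m + 1) with hY
  have hY0 : 0 < Y := by positivity
  have hYle : Y ≤ max 1 G * (C * √(R.errG P) + (P.m + 1)) := by
    have h1 := mul_le_mul_of_nonneg_right (le_max_left 1 G) hCs
    have h2 := mul_le_mul_of_nonneg_right (le_max_right 1 G) (by positivity : 0 ≤ (P.m : ℝ) + 1)
    rw [hY]; linarith
  calc P.violation R.x P.T = 2 * Y * (R.lam * P.violation R.x P.T) := by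
        rw [hlam]; field_simp
    _ ≤ 2 * Y * ((Real.log N / Real.log 2 + 8) * Real.log P.T) :=
        mul_le_mul_of_nonneg_left hlamV (by positivity)
    _ ≤ 2 * (max 1 G * (C * √(R.errG P) + (P.m + 1))) *
          ((Real.log N / Real.log 2 + 8) * Real.log P.T) := by
        have : 0 ≤ (Real.log N / Real.log 2 + 8) * Real.log P.T :=
          mul_nonneg (by positivity) hlogT
        gcongr
    _ = _ := by ring
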